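/- **Model.** A network is a connected simple graph $G=(V,E)$ on $n\ge 1$ vertices with pairwise distinct identifiers of at most $\kappa\,b(n)$ bits, where $\kappa\in\mathbb N$ is a constant and $b(n)=\lfloor\log_2 n\rfloor+1$; the edges at each vertex are numbered arbitrarily by ports. All vertices run the same algorithm, with unrestricted local computation, in synchronous rounds. Initially a vertex knows the parameters of the algorithm ($k$, $\varepsilon$ and, in part 2, $\delta$), the number $n$, its own identifier and its degree; in a randomized algorithm it also has private independent fair coin tosses. In each round every vertex sends a (possibly empty) bit string through each of its ports, receives the strings sent by its neighbours and updates its state. It is a CONGEST algorithm with bandwidth constant $B$ if all messages always have at most $B\,b(n)$ bits, i.e. $O(\log n)$ bits. Each vertex eventually halts with one of the answers "in the cover", "not in the cover", "no solution". **Problem.** For $\alpha\ge 1$ and $k\ge 1$, an execution *$\alpha$-approximates $k$-MVC* if the following holds. If $G$ has a vertex cover of size at most $k$, then the vertices answering "in the cover" form a vertex cover of $G$ of size at most $\alpha k$ and all other vertices answer "not in the cover". If $G$ has no vertex cover of size at most $k$, then either all vertices answer "no solution", or the vertices still output, in the same way, a vertex cover of $G$ of size at most $\alpha k$. (So the answer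 "no solution" always certifies that there is no vertex cover of size at most $k$, and an output cover always has size at most $\alpha k$.) **Theorem.** 1. For every $\kappa\in\mathbb N$ there are constants $B$ and $C$ such that for all integers $k\ge 1$ and all real $\varepsilon\in[1/k,1]$ there is a deterministic CONGEST algorithm with bandwidth constant $B$ that, on every network with identifiers of at most $\kappa\,b(n)$ bits, $(2-\varepsilon)$-approximates $k$-MVC and halts within $C\,(k+(k\varepsilon)^2)$ rounds. 2. For all $\kappa,c\in\mathbb N$ there are constants $B$ and $C$ such that for all integers $k\ge 1$, all real $\varepsilon\in[1/k,1]$ and all real $\delta\ge (k\varepsilon)^{-c}$ there is a randomized CONGEST algorithm with bandwidth constant $B$ that, on every network with identifiers of at most $\kappa\,b(n)$ bits, always halts within $$C\left(k+\frac{(k\varepsilon)^2\log(k\varepsilon)}{\log n}\right)$$ rounds (for $n=1$ the fraction is read as $0$) and, with probability at least $1-\delta$ over the coin tosses, $(2-\varepsilon)$-approximates $k$-MVC. -/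

import Mathlib

/-!
The CONGEST model of distributed computing and the parameterized vertex cover problem.
-/

namespace Congest

/-- A communication network on the vertex set `V`: a connected simple graph, pairwise distinct
identifiers, and at every vertex `v` an arbitrary numbering of the incident edges by the ports
`0, …, deg v - 1` (the equivalence forces `deg v` to be the degree of `v`). -/
structure Network (V : Type*) [Fintype V] where
  graph : SimpleGraph V
  connected : graph.Connected
  ident : V → ℕ
  ident_injective : Function.Injective ident
  deg : V → ℕ
  port : (v : V) → Fin (deg v) ≃ graph.neighborSet v

/-- All identifiers have at most `κ · (number of bits of n)` bits, where `n = |V|`. -/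
def Network.ShortIdents {V : Type*} [Fintype V] (N : Network V) (κ : ℕ) : Prop :=
  ∀ v, (N.ident v).size ≤ κ * (Fintype.card V).size

/-- The possible answers of a vertex for the parameterized vertex cover problem. -/
inductive Answer where
  | inCover
  | notInCover
  | noSolution

/-- A synchronous message-passing algorithm, run by every vertex; local computation is not
restricted. In an `n`-vertex network each vertex privately tosses `coins n` fair coins. It starts
from `n`, its own identifier, its degree and its coins. In each round it sends a bit string
through each of its ports (the empty string stands for no message) and then updates its state from
the strings received through its ports. It halts as soon as `answer` is not `none`. -/
structure Algorithm where
  State : Type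
  coins : ℕ → ℕ
  init : (n ident deg : ℕ) → (Fin (coins n) → Bool) → State
  send : State → (port : ℕ) → List Bool
  receive : State → (inbox : ℕ → List Bool) → State
  answer : State → Option Answer

namespace Algorithm

/-- A deterministic algorithm tosses no coins. -/
def IsDeterministic (A : Algorithm) : Prop :=
  ∀ n, A.coins n = 0

/-- The joint outcomes of the coin tosses of all vertices. -/
abbrev Coins (A : Algorithm) (V : Type*) [Fintype V] : Type _ :=
  V → Fin (A.coins (Fintype.card V)) → Bool

/-- The string that a vertex in state `s` puts on a port; a vertex that has halted is silent. -/
def outgoing (A : Algorithm) (s : A.State) (i : ℕ) : List Bool :=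
  match A.answer s with
  | none => A.send s i
  | some _ => []

/-- The new state after the strings `inbox` have arrived; a vertex that has halted does not
change any more. -/
def step (A : Algorithm) (s : A.State) (inbox : ℕ → List Bool) : A.State :=
  match A.answer s with
  | none => A.receive s inbox
  | some _ => s

variable {V : Type*} [Fintype V]

/-- The string that `v` receives through its port `i` when the vertices are in the states `s`. -/
def inbox (A : Algorithm) (N : Network V) (s : V → A.State) (v : V) (i : ℕ) : List Bool :=
  if h : i < N.deg v then
    let u : N.graph.neighborSet v := N.port v ⟨i, h⟩
    A.outgoing (s u) ((N.port u).symm ⟨v, SimpleGraph.Adj.symm u.2⟩)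
  else []

/-- The states of all vertices after `t` rounds. -/
def run (A : Algorithm) (N : Network V) (ω : A.Coins V) : ℕ → V → A.State
  | 0 => fun v => A.init (Fintype.card V) (N.ident v) (N.deg v) (ω v)
  | t + 1 => fun v => A.step (A.run N ω t v) (A.inbox N (A.run N ω t) v)

/-- Every message of the execution has at most `B · (number of bits of n)` bits. -/
def RespectsBandwidth (A : Algorithm) (N : Network V) (ω : A.Coins V) (B : ℕ) : Prop :=
  ∀ t v i, i < N.deg v →
    (A.outgoing (A.run N ω t v) i).length ≤ B * (Fintype.card V).size

/-- All vertices have halted after at most `R` rounds. -/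
def HaltsWithin (A : Algorithm) (N : Network V) (ω : A.Coins V) (R : ℝ) : Prop :=
  ∃ T : ℕ, (T : ℝ) ≤ R ∧ ∀ v, A.answer (A.run N ω T v) ≠ none

/-- In the execution, the final answer of the vertex `v` is `a`. -/
def Answers (A : Algorithm) (N : Network V) (ω : A.Coins V) (v : V) (a : Answer) : Prop :=
  ∃ T, A.answer (A.run N ω T v) = some a

/-- The answers describe a vertex cover with at most `s` vertices. -/
def FindsCover (A : Algorithm) (N : Network V) (ω : A.Coins V) (s : ℝ) : Prop :=
  ∃ S : Set V, N.graph.IsVertexCover S ∧ (S.ncard : ℝ) ≤ s ∧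
    (∀ v ∈ S, A.Answers N ω v .inCover) ∧ (∀ v ∉ S, A.Answers N ω v .notInCover)

/-- All vertices answer that there is no solution. -/
def Rejects (A : Algorithm) (N : Network V) (ω : A.Coins V) : Prop :=
  ∀ v, A.Answers N ω v .noSolution

/-- The execution `α`-approximates the vertex cover problem with parameter `k`: if there is a cover
with at most `k` vertices, it finds a cover with at most `α k` vertices; if there is none, all
vertices report so, unless the execution nevertheless finds a cover with at most `α k` vertices. -/
def Approximates (A : Algorithm) (N : Network V) (ω : A.Coins V) (α : ℝ) (k : ℕ) : Prop :=
  ((∃ S : Set V, N.graph.IsVertexCover S ∧ S.ncard ≤ k) → A.FindsCover N ω (α * k)) ∧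
  ((¬ ∃ S : Set V, N.graph.IsVertexCover S ∧ S.ncard ≤ k) →
    A.Rejects N ω ∨ A.FindsCover N ω (α * k))

/-- The probability, over independent fair coins, that the execution is not correct. -/
noncomputable def errorProbability (A : Algorithm) (N : Network V) (α : ℝ) (k : ℕ) : ℝ :=
  ({ω : A.Coins V | ¬ A.Approximates N ω α k}.ncard : ℝ) / (Nat.card (A.Coins V) : ℝ)

end Algorithm

end Congest

namespace Congest

open Finset
open scoped Classical

noncomputable section

/-! Put `r = ⌈kε⌉` and `m = k - r`. Both endpoints of `m` edges of a maximal matching are put into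
the cover, and the rest is covered by at most `r` further vertices. A cover of size at most `k`
contains an endpoint of each of these disjoint edges, so at most `r` of its vertices lie outside
them. The total is `2m + r = 2k - r ≤ (2 - ε)k`.

The matching is built greedily by identifiers for `k + 1` phases, each of which adds an edge unless
the matching is already maximal (`exec_phase`). Flooding then makes it known everywhere in `O(k)`
rounds (`exec_flood`). More than `k` edges exclude a cover of size `k`. With at most `k` edges in a
maximal matching the diameter is at most `4k + 1`, because along a shortest path every second edge
has a matched endpoint (`bad_of_dist_lt`). Hence `exec_removalSteps`: either all vertices reject
correctly, or all agree on the same removed set `X`.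

On the remaining graph a Buss kernel is used: a vertex of degree above `r` belongs to every cover of
size at most `r`, and is recorded as a loop; the other edges number at most `r ^ 2` if such a cover
exists (`card_le_of_subset_kernel`). All vertices collect the kernel, with `q` tokens per message,
in `O(k + r ^ 2 / q)` rounds and solve it locally in the same way (`output_coverSteps`). With
identifiers as labels and `q = 1` this gives the deterministic bound.

For the randomized bound, kernel vertices are named by random labels of `O(log r)` bits, so that
about `log n / log r` tokens fit into a message. The labels only have to be distinct on a set of
`O(r ^ 2)` vertices that is fixed before they are drawn (`exists_witness`), and a union bound over
its pairs gives failure probability at most `r ^ (-c)`. If such labels would be longer than `n.size`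
bits, identifiers are used and nothing can fail.

The program is written for a broadcast model in which a vertex sees only the union of its
neighbours' messages; `toAlgorithm` translates it into CONGEST. -/

/-- A message of the abstract broadcast model: a finite set of pairs of numbers. -/
abbrev Msg := Finset (ℕ × ℕ)

/-- The memory of a vertex. -/
structure LocalState where
  ident : ℕ
  lab : ℕ
  partner : Option ℕ
  target : Option ℕ
  own : Msg
  known : Msg
  sent : Msg
  removed : Finset ℕ
  hdeg : ℕ
  failed : Prop

/-- One round of a broadcast protocol: every vertex sends `msg` to all its neighbours and then
updates its memory from the union of the messages of its neighbours. -/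
structure Step where
  msg : LocalState → Msg
  upd : LocalState → Msg → LocalState

/-! ### Broadcast programs and their executions. -/

section Exec

variable {V : Type*} [Fintype V] (G : SimpleGraph V)

/-- The union of the messages of the neighbours of a vertex. -/
def gather (f : V → Msg) (v : V) : Msg :=
  (univ.filter fun u => G.Adj v u).biUnion f

variable {G} in
lemma mem_gather {f : V → Msg} {v : V} {p : ℕ × ℕ} :
    p ∈ gather G f v ↔ ∃ u, G.Adj v u ∧ p ∈ f u := by
  simp [gather]

/-- The configuration after one round. -/
def Step.apply (st : Step) (c : V → LocalState) : V → LocalState :=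
  fun v => st.upd (c v) (gather G (fun u => st.msg (c u)) v)

/-- The configuration after a sequence of rounds. -/
def exec : List Step → (V → LocalState) → V → LocalState
  | [], c => c
  | st :: l, c => exec l (st.apply G c)

/-- All messages sent in the course of an execution belong to `P`. -/
def Legal (P : Set Msg) : List Step → (V → LocalState) → Prop
  | [], _ => True
  | st :: l, c => (∀ v, st.msg (c v) ∈ P) ∧ Legal P l (st.apply G c)

lemma exec_append (l₁ l₂ : List Step) (c : V → LocalState) :
    exec G (l₁ ++ l₂) c = exec G l₂ (exec G l₁ c) := by
  induction l₁ generalizing c with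
  | nil => rfl
  | cons st l ih => exact ih _

lemma legal_append {P : Set Msg} {l₁ l₂ : List Step} {c : V → LocalState}
    (h₁ : Legal G P l₁ c) (h₂ : Legal G P l₂ (exec G l₁ c)) : Legal G P (l₁ ++ l₂) c := by
  induction l₁ generalizing c with
  | nil => exact h₂
  | cons st l ih => exact ⟨h₁.1, ih h₁.2 h₂⟩

lemma legal_drop {P : Set Msg} {l : List Step} {c : V → LocalState} (h : Legal G P l c) (t : ℕ) :
    Legal G P (l.drop t) (exec G (l.take t) c) := by
  induction t generalizing l c with
  | zero => exact h
  | succ t ih =>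
    cases l with
    | nil => trivial
    | cons st l => exact ih h.2

/-- The steps do not look at the labels. -/
def LabelFree (st : Step) : Prop :=
  ∀ s x, st.msg { s with lab := x } = st.msg s ∧
    ∀ I, st.upd { s with lab := x } I = { st.upd s I with lab := x }

/-- This makes the outcome of the matching part independent of the random labels, so that the set on
which labels must be distinct can be chosen before they are drawn. -/
lemma exec_labelFree {l : List Step} (hl : ∀ st ∈ l, LabelFree st) (c : V → LocalState)
    (x : V → ℕ) :
    exec G l (fun v => { c v with lab := x v }) = fun v => { exec G l c v with lab := x v } := by
  induction l generalizing c with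
  | nil => rfl
  | cons st l ih =>
    have hst := hl st (by simp)
    have : st.apply G (fun v => { c v with lab := x v })
        = fun v => { st.apply G c v with lab := x v } := by
      funext v
      simp only [Step.apply]
      rw [(hst _ _).2]
      simp only [(hst _ _).1]
    simp only [exec]
    rw [this, ih fun s hs => hl s (by simp [hs])]

end Exec

/-! ### Simulation of broadcast programs in CONGEST. -/

/-- The CONGEST algorithm that executes a program in the broadcast model. -/
def toAlgorithm (coins : ℕ → ℕ)
    (start : (n : ℕ) → ℕ → (Fin (coins n) → Bool) → LocalState)
    (steps : ℕ → List Step) (out : ℕ → LocalState → Answer)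
    (enc : ℕ → Msg → List Bool) (dec : ℕ → List Bool → Msg) : Algorithm where
  State := ℕ × ℕ × List Step × LocalState
  coins := coins
  init n i d ω := (n, d, steps n, start n i ω)
  send s _ := match s with
    | (_, _, [], _) => []
    | (n, _, st :: _, x) => enc n (st.msg x)
  receive s inbox := match s with
    | (n, d, [], x) => (n, d, [], x)
    | (n, d, st :: l, x) => (n, d, l, st.upd x ((range d).biUnion fun i => dec n (inbox i)))
  answer s := match s with
    | (n, _, [], x) => some (out n x)
    | (_, _, _ :: _, _) => none

section Simulation

variable {coins : ℕ → ℕ} {start : (n : ℕ) → ℕ → (Fin (coins n) → Bool) → LocalState}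
  {steps : ℕ → List Step} {out : ℕ → LocalState → Answer}
  {enc : ℕ → Msg → List Bool} {dec : ℕ → List Bool → Msg}
  {V : Type*} [Fintype V] (N : Network V)
  (ω : V → Fin (coins (Fintype.card V)) → Bool)

/-- Since all messages of a legal run survive encoding and decoding, the union over the ports of the
decoded inbox is exactly `gather`. Surjectivity of the port numbering ensures that no neighbour is
missed. -/
lemma run_toAlgorithm {P : Set Msg}
    (hdec : ∀ x ∈ P, dec (Fintype.card V) (enc (Fintype.card V) x) = x)
    (hP : Legal N.graph P (steps (Fintype.card V))
      fun v => start (Fintype.card V) (N.ident v) (ω v)) (t : ℕ) (v : V) :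
    (toAlgorithm coins start steps out enc dec).run N ω t v =
      (Fintype.card V, N.deg v, (steps (Fintype.card V)).drop t,
        exec N.graph ((steps (Fintype.card V)).take t)
          (fun v => start (Fintype.card V) (N.ident v) (ω v)) v) := by
  induction t generalizing v with
  | zero => rfl
  | succ t ih =>
    set A := toAlgorithm coins start steps out enc dec with hA
    set l := steps (Fintype.card V) with hl
    set c₀ : V → LocalState := fun v => start (Fintype.card V) (N.ident v) (ω v) with hc₀
    change A.step (A.run N ω t v) (A.inbox N (A.run N ω t) v) = _
    have hleg := legal_drop N.graph hP t
    rcases hd : l.drop t with _ | ⟨st, l'⟩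
    · have hlen : l.length ≤ t := by simpa using hd
      rw [ih v, hd]
      simp only [Algorithm.step, A, toAlgorithm]
      rw [List.drop_eq_nil_of_le (by omega), List.take_of_length_le hlen,
        List.take_of_length_le (by omega)]
    · rw [hd] at hleg
      have htake : l.take (t + 1) = l.take t ++ [st] := by
        have hlt : t < l.length := by
          by_contra h
          rw [List.drop_eq_nil_of_le (by omega)] at hd
          cases hd
        have h1 := List.drop_eq_getElem_cons hlt
        rw [hd] at h1
        rw [List.take_succ_eq_append_getElem hlt, ← (List.cons.inj h1).1]
      have hdrop : l.drop (t + 1) = l' := by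
        rw [← List.tail_drop, hd, List.tail_cons]
      have hinbox : (range (N.deg v)).biUnion
          (fun i => dec (Fintype.card V) (A.inbox N (A.run N ω t) v i))
          = gather N.graph (fun u => st.msg (exec N.graph (l.take t) c₀ u)) v := by
        have key : ∀ i (h : i < N.deg v), dec (Fintype.card V) (A.inbox N (A.run N ω t) v i)
            = st.msg (exec N.graph (l.take t) c₀ (N.port v ⟨i, h⟩)) := by
          intro i h
          simp only [Algorithm.inbox, h, dif_pos, Algorithm.outgoing]
          rw [ih, hd]
          simp only [A, toAlgorithm]
          exact hdec _ (hleg.1 _)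
        ext p
        simp only [mem_biUnion, Finset.mem_range, mem_gather]
        constructor
        · rintro ⟨i, hi, hp⟩
          rw [key i hi] at hp
          exact ⟨_, (N.port v ⟨i, hi⟩).2, hp⟩
        · rintro ⟨u, hu, hp⟩
          obtain ⟨i, hi⟩ := (N.port v).surjective ⟨u, hu⟩
          refine ⟨i, i.2, ?_⟩
          rw [key i i.2]
          simpa [hi] using hp
      rw [hdrop, htake, exec_append, ih v, hd]
      simp only [Algorithm.step, A, toAlgorithm] at hinbox ⊢
      rw [hinbox]
      rfl

/-- What a CONGEST execution of a legal program looks like from outside. -/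
lemma toAlgorithm_spec {P : Set Msg} {B : ℕ}
    (hdec : ∀ x ∈ P, dec (Fintype.card V) (enc (Fintype.card V) x) = x)
    (hlen : ∀ x ∈ P, (enc (Fintype.card V) x).length ≤ B * (Fintype.card V).size)
    (hP : Legal N.graph P (steps (Fintype.card V))
      fun v => start (Fintype.card V) (N.ident v) (ω v)) :
    (toAlgorithm coins start steps out enc dec).RespectsBandwidth N ω B ∧
    (∀ R : ℝ, ((steps (Fintype.card V)).length : ℝ) ≤ R →
      (toAlgorithm coins start steps out enc dec).HaltsWithin N ω R) ∧
    ∀ v, (toAlgorithm coins start steps out enc dec).Answers N ω v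
      (out (Fintype.card V) (exec N.graph (steps (Fintype.card V))
        (fun v => start (Fintype.card V) (N.ident v) (ω v)) v)) := by
  refine ⟨?_, ?_, ?_⟩
  · intro t v i _
    simp only [Algorithm.outgoing]
    rw [run_toAlgorithm N ω hdec hP]
    have hleg := legal_drop N.graph hP t
    rcases hd : (steps (Fintype.card V)).drop t with _ | ⟨st, l'⟩
    · simp [toAlgorithm]
    · rw [hd] at hleg
      simpa [toAlgorithm] using hlen _ (hleg.1 v)
  · intro R hR
    refine ⟨_, hR, fun v => ?_⟩
    rw [run_toAlgorithm N ω hdec hP]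
    simp [toAlgorithm]
  · intro v
    refine ⟨(steps (Fintype.card V)).length, ?_⟩
    rw [run_toAlgorithm N ω hdec hP]
    simp [toAlgorithm]

end Simulation

/-! ### Counting and encoding messages. -/

/-- Messages with at most `q` pairs of numbers of at most `w` bits. -/
def Small (w q : ℕ) : Set Msg :=
  {x | x.card ≤ q ∧ ∀ p ∈ x, p.1 < 2 ^ w ∧ p.2 < 2 ^ w}

/-- A message fills `q` slots, each of which is empty or holds one of `2 ^ (2 * w)` pairs; this
leaves at most `2 ^ (2 * w + 1)` choices per slot. -/
lemma finite_small_and_ncard_le (w q : ℕ) :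
    (Small w q).Finite ∧ (Small w q).ncard ≤ 2 ^ ((2 * w + 1) * q) := by
  set U : Finset (ℕ × ℕ) := range (2 ^ w) ×ˢ range (2 ^ w) with hU
  let F : (Fin q → Option U) → Msg := fun f =>
    univ.biUnion fun i => (f i).elim ∅ fun u => {u.1}
  have hsub : Small w q ⊆ Set.range F := by
    rintro x ⟨hx, hb⟩
    have hxU : ∀ p ∈ x, p ∈ U := fun p hp => by simpa [hU] using hb p hp
    obtain ⟨e⟩ : Nonempty (x ↪ Fin q) := by
      apply Function.Embedding.nonempty_of_card_le
      simpa using hx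
    refine ⟨fun i => if h : ∃ p, e p = i then some ⟨h.choose.1, hxU _ h.choose.2⟩ else none, ?_⟩
    ext p
    simp only [F, mem_biUnion, mem_univ, true_and]
    constructor
    · rintro ⟨i, hi⟩
      split_ifs at hi with h
      · simp only [Option.elim_some, mem_singleton] at hi
        rw [hi]
        exact h.choose.2
      · simp at hi
    · intro hp
      refine ⟨e ⟨p, hp⟩, ?_⟩
      have h : ∃ p', e p' = e ⟨p, hp⟩ := ⟨_, rfl⟩
      rw [dif_pos h]
      simp
  have hfin : (Set.range F).Finite := Set.finite_range F
  refine ⟨hfin.subset hsub, (Set.ncard_le_ncard hsub hfin).trans ?_⟩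
  have h1 : (Set.range F).ncard ≤ Fintype.card (Fin q → Option U) := by
    rw [← Set.image_univ, ← Nat.card_eq_fintype_card, ← Set.ncard_univ]
    exact Set.ncard_image_le
  refine h1.trans ?_
  have hcU : Fintype.card (Option U) ≤ 2 ^ (2 * w + 1) := by
    simp only [Fintype.card_option, Fintype.card_coe, hU, card_product, card_range]
    have : 1 ≤ 2 ^ w := Nat.one_le_two_pow
    calc 2 ^ w * 2 ^ w + 1 ≤ 2 ^ w * 2 ^ w + 2 ^ w * 2 ^ w := by nlinarith
      _ = 2 ^ (2 * w + 1) := by ring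
  rw [Fintype.card_fun, Fintype.card_fin, pow_mul]
  exact Nat.pow_le_pow_left hcU q

/-- A set of at most `2 ^ L` messages can be encoded by strings of `L` bits. -/
lemma exists_code {P : Set Msg} (hfin : P.Finite) {L : ℕ} (hcard : P.ncard ≤ 2 ^ L) :
    ∃ (enc : Msg → List Bool) (dec : List Bool → Msg),
      (∀ x ∈ P, dec (enc x) = x) ∧ ∀ x ∈ P, (enc x).length ≤ L := by
  have := hfin.fintype
  obtain ⟨e⟩ : Nonempty (P ↪ (Fin L → Bool)) := by
    apply Function.Embedding.nonempty_of_card_le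
    rw [← Set.toFinset_card, ← Set.ncard_eq_toFinset_card']
    simpa using hcard
  let enc : Msg → List Bool := fun x => if h : x ∈ P then List.ofFn (e ⟨x, h⟩) else []
  have hinj : Set.InjOn enc P := by
    intro x hx y hy hxy
    simp only [enc, hx, hy, dif_pos] at hxy
    exact congrArg Subtype.val (e.injective (List.ofFn_injective hxy))
  refine ⟨enc, Function.invFunOn enc P, fun x hx => hinj.leftInvOn_invFunOn hx, ?_⟩
  intro x hx
  simp [enc, hx]

/-! ### Dissemination of tokens -/

lemma exists_pick (q : ℕ) (x : Msg) : ∃ y ⊆ x, y.card = min q x.card :=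
  exists_subset_card_eq (min_le_right _ _)

/-- A subset of `x` with `q` elements if `x` is large enough, and `x` itself otherwise. -/
def pick (q : ℕ) (x : Msg) : Msg := (exists_pick q x).choose

lemma pick_subset (q : ℕ) (x : Msg) : pick q x ⊆ x := (exists_pick q x).choose_spec.1

lemma card_pick (q : ℕ) (x : Msg) : (pick q x).card = min q x.card :=
  (exists_pick q x).choose_spec.2

/-- Every vertex forwards `q` known tokens that it has not sent before. -/
def floodStep (q : ℕ) : Step where
  msg s := pick q (s.known \ s.sent)
  upd s I := { s with known := s.known ∪ I, sent := s.sent ∪ pick q (s.known \ s.sent) }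

lemma exists_adj_dist {V : Type*} {G : SimpleGraph V} (hG : G.Connected) {v u : V}
    {d : ℕ} (h : G.dist v u = d + 1) :
    ∃ w, G.Adj v w ∧ G.dist w u = d := by
  obtain ⟨p, hp⟩ := hG.exists_walk_length_eq_dist v u
  cases p with
  | nil => simp at h
  | @cons _ w _ hadj p =>
    refine ⟨w, hadj, ?_⟩
    rw [SimpleGraph.Walk.length_cons] at hp
    have h1 := SimpleGraph.dist_le p
    have h2 := hG.dist_triangle (u := v) (v := w) (w := u)
    have h3 := SimpleGraph.dist_eq_one_iff_adj.2 hadj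
    omega

section Flood

variable {V : Type*} [Fintype V] {G : SimpleGraph V}

/-- After `t` rounds of flooding, every vertex knows either all tokens that start within
distance `s`, or at least `q * (t + 1 - s)` tokens. -/
lemma exec_flood (hG : G.Connected) (q : ℕ) (c : V → LocalState) (K : V → Msg)
    (hK : ∀ v, (c v).known = K v) (hs : ∀ v, (c v).sent = ∅) (t : ℕ) :
    ∃ kn se : V → Msg,
      exec G (List.replicate t (floodStep q)) c
        = (fun v => { c v with known := kn v, sent := se v }) ∧
      (∀ v, kn v ⊆ univ.biUnion K) ∧ (∀ v, K v ⊆ kn v) ∧ (∀ v, se v ⊆ kn v) ∧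
      (∀ v u, G.Adj v u → se u ⊆ kn v) ∧
      (∀ s ≤ t, ∀ v, q * (t - s) ≤ (se v).card ∨ ∀ u, G.dist v u ≤ s → K u ⊆ se v) ∧
      (∀ s ≤ t, ∀ v, q * (t + 1 - s) ≤ (kn v).card ∨ ∀ u, G.dist v u ≤ s → K u ⊆ kn v) := by
  have dist0 : ∀ v u, G.dist v u ≤ 0 → u = v := fun v u h =>
    ((hG.dist_eq_zero_iff).1 (Nat.le_zero.1 h)).symm
  induction t with
  | zero =>
    refine ⟨K, fun _ => ∅, ?_, fun v => subset_biUnion_of_mem K (mem_univ v), fun v => subset_rfl,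
      by simp, by simp, by simp, ?_⟩
    · funext v
      simp only [List.replicate_zero, exec, ← hK, ← hs v]
    · intro s hs v
      right
      intro u hu
      rw [dist0 v u (by omega)]
  | succ t ih =>
    obtain ⟨kn, se, hex, hknK, hKkn, hse, hadj, hB, hA⟩ := ih
    set se' : V → Msg := fun v => se v ∪ pick q (kn v \ se v) with hse'
    set kn' : V → Msg := fun v => kn v ∪ gather G (fun u => pick q (kn u \ se u)) v with hkn'
    have hpick : ∀ v, pick q (kn v \ se v) ⊆ kn v := fun v =>
      (pick_subset _ _).trans sdiff_subset
    have hB' : ∀ s ≤ t + 1, ∀ v,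
        q * (t + 1 - s) ≤ (se' v).card ∨ ∀ u, G.dist v u ≤ s → K u ⊆ se' v := by
      intro s hs v
      rcases Nat.lt_or_ge t s with hlt | hst
      · left
        rw [show t + 1 - s = 0 by omega]
        simp
      -- If at most `q` tokens are unsent, this round sends everything known, and the bound on known
      -- tokens at time `t` carries over to the sent ones. Otherwise exactly `q` new tokens leave.
      by_cases hq : (kn v \ se v).card ≤ q
      · have h1 : se' v = kn v := by
          have : pick q (kn v \ se v) = kn v \ se v :=
            eq_of_subset_of_card_le (pick_subset _ _) (by rw [card_pick]; omega)
          simp only [hse', this]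
          exact union_sdiff_of_subset (hse v)
        rw [h1]
        exact hA s hst v
      · rcases hB s hst v with h | h
        · left
          have h2 : (se' v).card = (se v).card + q := by
            rw [hse']
            simp only
            rw [card_union_of_disjoint, card_pick]
            · omega
            · exact disjoint_of_subset_right (pick_subset _ _) disjoint_sdiff
          rw [h2, show t + 1 - s = (t - s) + 1 by omega, mul_add]
          omega
        · right
          exact fun u hu => (h u hu).trans subset_union_left
    have hadj' : ∀ v u, G.Adj v u → se' u ⊆ kn' v := by
      intro v u huv
      refine union_subset ((hadj v u huv).trans subset_union_left) ?_
      intro p hp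
      exact mem_union_right _ (mem_gather.2 ⟨u, huv, hp⟩)
    have hown' : ∀ v, se' v ⊆ kn' v := fun v =>
      (union_subset (hse v) (hpick v)).trans subset_union_left
    refine ⟨kn', se', ?_, ?_, fun v => (hKkn v).trans subset_union_left, hown', hadj', hB', ?_⟩
    · rw [List.replicate_succ', exec_append, hex]
      rfl
    · intro v
      refine union_subset (hknK v) ?_
      intro p hp
      obtain ⟨u, -, hp⟩ := mem_gather.1 hp
      exact hknK u (hpick u hp)
    · intro s hs v
      rcases s with _ | s
      · right
        intro u hu
        rw [dist0 v u hu]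
        exact (hKkn v).trans subset_union_left
      -- Either some vertex of the closed neighbourhood has sent enough tokens by itself, or all of
      -- them have sent their whole balls of radius `s`, which together cover the ball of radius `s
      -- + 1` around `v`.
      · by_cases hex : ∃ w, (G.Adj v w ∨ v = w) ∧ q * (t + 1 - s) ≤ (se' w).card
        · obtain ⟨w, hw, hcard⟩ := hex
          left
          have : se' w ⊆ kn' v := by
            rcases hw with hw | rfl
            · exact hadj' v w hw
            · exact hown' v
          have := card_le_card this
          rw [show t + 1 + 1 - (s + 1) = t + 1 - s by omega]
          omega
        · right
          push Not at hex
          have hball : ∀ w, (G.Adj v w ∨ v = w) → ∀ u, G.dist w u ≤ s → K u ⊆ se' w := by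
            intro w hw
            rcases hB' s (by omega) w with h | h
            · exact absurd h (by have := hex w hw; omega)
            · exact h
          intro u hu
          rcases Nat.lt_or_ge s (G.dist v u) with hlt | hle
          · obtain ⟨w, hw, hd⟩ := exists_adj_dist hG (show G.dist v u = s + 1 by omega)
            exact (hball w (Or.inl hw) u hd.le).trans (hadj' v w hw)
          · exact (hball v (Or.inr rfl) u hle).trans (hown' v)

lemma legal_flood {P : Set Msg} (hG : G.Connected) (q : ℕ) (c : V → LocalState) (K : V → Msg)
    (hK : ∀ v, (c v).known = K v) (hs : ∀ v, (c v).sent = ∅)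
    (hP : ∀ x ⊆ univ.biUnion K, x.card ≤ q → x ∈ P) (t : ℕ) :
    Legal G P (List.replicate t (floodStep q)) c := by
  induction t with
  | zero => trivial
  | succ t ih =>
    rw [List.replicate_succ']
    refine legal_append G ih ⟨fun v => ?_, trivial⟩
    obtain ⟨kn, se, hex, hknK, -⟩ := exec_flood hG q c K hK hs t
    rw [hex]
    exact hP _ ((pick_subset _ _).trans (sdiff_subset.trans (hknK v)))
      ((card_pick _ _).trans_le (min_le_left _ _))

end Flood

/-! ### A maximal matching -/

/-- Every free vertex announces itself; the free vertices then select the free neighbour with the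
smallest identifier. -/
def pointStep : Step where
  msg s := if s.partner = none then {(s.ident, s.ident)} else ∅
  upd s I := { s with
    target := if s.partner = none ∧ I.Nonempty then some (sInf {a | ∃ b, (a, b) ∈ I}) else none }

/-- Two vertices that have selected each other become partners. -/
def matchStep : Step where
  msg s := s.target.elim ∅ fun j => {(s.ident, j)}
  upd s I := { s with
    partner := if ∃ j, s.target = some j ∧ (j, s.ident) ∈ I then s.target else s.partner }

section Matching

variable {V : Type*} [Fintype V] {G : SimpleGraph V}

/-- Partners are mutual neighbours. -/
def IsPairing (G : SimpleGraph V) (ids : V → ℕ) (par : V → Option ℕ) : Prop :=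
  ∀ v j, par v = some j → ∃ u, G.Adj v u ∧ ids u = j ∧ par u = some (ids v)

/-- The targets selected by `pointStep`. -/
def IsTarget (G : SimpleGraph V) (ids : V → ℕ) (par tgt : V → Option ℕ) : Prop :=
  ∀ v, (∀ j, tgt v = some j → par v = none ∧ ∃ u, G.Adj v u ∧ par u = none ∧ ids u = j ∧
      ∀ w, G.Adj v w → par w = none → ids u ≤ ids w) ∧
    (∀ u, par v = none → G.Adj v u → par u = none → tgt v ≠ none)

lemma apply_pointStep {ids : V → ℕ} (c : V → LocalState) (hid : ∀ v, (c v).ident = ids v) :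
    ∃ tgt, pointStep.apply G c = (fun v => { c v with target := tgt v }) ∧
      IsTarget G ids (fun v => (c v).partner) tgt := by
  refine ⟨_, rfl, fun v => ?_⟩
  set I := gather G (fun u => pointStep.msg (c u)) v with hI
  have hmem : ∀ a b, (a, b) ∈ I ↔ ∃ u, G.Adj v u ∧ (c u).partner = none ∧ ids u = a ∧ a = b := by
    intro a b
    rw [hI, mem_gather]
    refine exists_congr fun u => and_congr_right fun _ => ?_
    simp only [pointStep, hid]
    split_ifs with h
    · simp only [mem_singleton, Prod.mk.injEq, h, true_and]
      constructor
      · rintro ⟨rfl, rfl⟩; exact ⟨rfl, rfl⟩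
      · rintro ⟨rfl, rfl⟩; exact ⟨rfl, rfl⟩
    · simp [h]
  constructor
  · intro j hj
    split_ifs at hj with h
    obtain ⟨h1, ⟨a, b⟩, hab⟩ := h
    refine ⟨h1, ?_⟩
    have hj' : sInf {a | ∃ b, (a, b) ∈ I} = j := Option.some.inj hj
    have hm : sInf {a | ∃ b, (a, b) ∈ I} ∈ {a | ∃ b, (a, b) ∈ I} := Nat.sInf_mem ⟨a, b, hab⟩
    rw [hj'] at hm
    obtain ⟨b', hb'⟩ := hm
    obtain ⟨u, hu, hpu, hidu, -⟩ := (hmem _ _).1 hb'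
    refine ⟨u, hu, hpu, hidu, fun w hw hpw => ?_⟩
    rw [hidu, ← hj']
    exact Nat.sInf_le ⟨ids w, (hmem _ _).2 ⟨w, hw, hpw, rfl, rfl⟩⟩
  · intro u hv hu hpu
    rw [if_pos ⟨hv, ⟨(ids u, ids u), (hmem _ _).2 ⟨u, hu, hpu, rfl, rfl⟩⟩⟩]
    simp

lemma apply_matchStep {ids : V → ℕ} (c : V → LocalState)
    (hid : ∀ v, (c v).ident = ids v) :
    ∃ par : V → Option ℕ, matchStep.apply G c = (fun v => { c v with partner := par v }) ∧
      (∀ v u, G.Adj v u → (c v).target = some (ids u) → (c u).target = some (ids v) →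
        par v = some (ids u)) ∧
      (∀ v, par v = (c v).partner ∨ ∃ u, G.Adj v u ∧ (c v).target = some (ids u) ∧
        (c u).target = some (ids v) ∧ par v = some (ids u)) := by
  refine ⟨_, rfl, ?_⟩
  have hmem : ∀ v j, (j, (c v).ident) ∈ gather G (fun u => matchStep.msg (c u)) v ↔
      ∃ u, G.Adj v u ∧ ids u = j ∧ (c u).target = some (ids v) := by
    intro v j
    rw [mem_gather]
    refine exists_congr fun u => and_congr_right fun _ => ?_
    simp only [matchStep, hid]
    rcases (c u).target with _ | i
    · simp
    · simp only [Option.elim_some, mem_singleton, Prod.mk.injEq, Option.some.injEq]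
      constructor
      · rintro ⟨rfl, rfl⟩; exact ⟨rfl, rfl⟩
      · rintro ⟨rfl, rfl⟩; exact ⟨rfl, rfl⟩
  simp only [hmem]
  constructor
  · intro v u huv h1 h2
    rw [if_pos ⟨ids u, h1, u, huv, rfl, h2⟩, h1]
  · intro v
    split_ifs with h
    · right
      obtain ⟨j, hj, u, huv, rfl, h2⟩ := h
      exact ⟨u, huv, hj, h2, hj⟩
    · exact Or.inl rfl

/-- The number of vertices that have a partner. -/
def matchedCard (par : V → Option ℕ) : ℕ := (univ.filter fun v => par v ≠ none).card

/-- No edge joins two vertices without partners. -/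
def IsMaximal (G : SimpleGraph V) (par : V → Option ℕ) : Prop :=
  ∀ v u, G.Adj v u → par v ≠ none ∨ par u ≠ none

/-- Progress comes from the smallest identifier among the free vertices with a free neighbour:
whichever neighbour that vertex selects must select it in return. Old pairs persist because only
free vertices have targets. -/
lemma exec_phase {ids : V → ℕ} (hinj : Function.Injective ids) (c : V → LocalState)
    (hid : ∀ v, (c v).ident = ids v) (hpair : IsPairing G ids fun v => (c v).partner) :
    ∃ par tgt : V → Option ℕ, exec G [pointStep, matchStep] c
        = (fun v => { c v with partner := par v, target := tgt v }) ∧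
      IsPairing G ids par ∧
      (IsMaximal G (fun v => (c v).partner) → IsMaximal G par) ∧
      (IsMaximal G (fun v => (c v).partner) ∨
        matchedCard (fun v => (c v).partner) + 2 ≤ matchedCard par) := by
  obtain ⟨tgt, h1, htgt⟩ := apply_pointStep (G := G) c hid
  obtain ⟨par, h2, hnew, hold⟩ :=
    apply_matchStep (G := G) (fun v => { c v with target := tgt v }) hid
  have hmono : ∀ v, (c v).partner ≠ none → par v ≠ none := by
    intro v hv
    rcases hold v with h | ⟨u, -, -, -, h⟩
    · rwa [h]
    · simp [h]
  refine ⟨par, tgt, ?_, ?_, fun hmax v u huv => (hmax v u huv).imp (hmono v) (hmono u), ?_⟩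
  · simp only [exec, h1, h2]
  · intro v j hj
    rcases hold v with h | ⟨u, huv, hu1, hu2, hu3⟩
    · obtain ⟨u, huv, hu, hpu⟩ := hpair v j (h.symm.trans hj)
      refine ⟨u, huv, hu, ?_⟩
      rcases hold u with h' | ⟨w, -, hw, -, -⟩
      · rw [h']; exact hpu
      · have := ((htgt u).1 _ hw).1
        simp only [hpu] at this
        cases this
    · refine ⟨u, huv, ?_, hnew u v huv.symm hu2 hu1⟩
      rw [hu3] at hj
      exact Option.some.inj hj
  · by_cases hmax : IsMaximal G fun v => (c v).partner
    · exact Or.inl hmax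
    · right
      simp only [IsMaximal] at hmax
      push Not at hmax
      obtain ⟨v₀, u₀, h₀, hv₀, hu₀⟩ := hmax
      obtain ⟨v, hv, hmin⟩ := exists_min_image
        (univ.filter fun v => (c v).partner = none ∧ ∃ u, G.Adj v u ∧ (c u).partner = none) ids
        ⟨v₀, by simp only [mem_filter, mem_univ, true_and]; exact ⟨hv₀, u₀, h₀, hu₀⟩⟩
      simp only [mem_filter, mem_univ, true_and] at hv hmin
      obtain ⟨hv, u₁, hvu₁, hu₁⟩ := hv
      obtain ⟨j, hj⟩ := Option.ne_none_iff_exists'.1 ((htgt v).2 u₁ hv hvu₁ hu₁)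
      obtain ⟨-, u, hvu, hu, rfl, -⟩ := (htgt v).1 j hj
      obtain ⟨j, hj'⟩ := Option.ne_none_iff_exists'.1 ((htgt u).2 v hu hvu.symm hv)
      obtain ⟨-, w, huw, hw, rfl, hwmin⟩ := (htgt u).1 j hj'
      have hwv : w = v := hinj (le_antisymm (hwmin v hvu.symm hv) (hmin w ⟨hw, u, huw.symm, hu⟩))
      subst hwv
      have hp1 := hnew w u hvu hj hj'
      have hp2 := hnew u w huw hj' hj
      have hsub : insert w (insert u (univ.filter fun v => (c v).partner ≠ none)) ⊆
          univ.filter fun v => par v ≠ none := by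
        intro x hx
        simp only [mem_insert, mem_filter, mem_univ, true_and] at hx ⊢
        rcases hx with rfl | rfl | hx
        · simp [hp1]
        · simp [hp2]
        · exact hmono x hx
      have := card_le_card hsub
      rw [card_insert_of_notMem, card_insert_of_notMem] at this
      · exact this
      · simpa using hu
      · simpa [hvu.ne] using hv

lemma legal_phase {P : Set Msg} {ids : V → ℕ} (c : V → LocalState)
    (hid : ∀ v, (c v).ident = ids v) (h0 : ∅ ∈ P) (hP : ∀ u v, {(ids u, ids v)} ∈ P) :
    Legal G P [pointStep, matchStep] c := by
  obtain ⟨tgt, h1, htgt⟩ := apply_pointStep (G := G) c hid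
  refine ⟨fun v => ?_, fun v => ?_, trivial⟩
  · simp only [pointStep]
    split_ifs
    · rw [hid]; exact hP v v
    · exact h0
  · rw [h1]
    simp only [matchStep]
    rcases h : tgt v with _ | j
    · exact h0
    · obtain ⟨-, u, -, -, rfl, -⟩ := (htgt v).1 j h
      simp only [Option.elim_some, hid]
      exact hP v u

/-- The program that finds a maximal matching or at least `p` disjoint edges. -/
def matchSteps : ℕ → List Step
  | 0 => []
  | p + 1 => matchSteps p ++ [pointStep, matchStep]

lemma length_matchSteps (p : ℕ) : (matchSteps p).length = 2 * p := by
  induction p with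
  | zero => rfl
  | succ p ih => simp [matchSteps, ih]; ring

lemma exec_matchSteps {ids : V → ℕ} (hinj : Function.Injective ids) (c : V → LocalState)
    (hid : ∀ v, (c v).ident = ids v) (hpar : ∀ v, (c v).partner = none) (p : ℕ) :
    ∃ par tgt : V → Option ℕ, exec G (matchSteps p) c
        = (fun v => { c v with partner := par v, target := tgt v }) ∧
      IsPairing G ids par ∧ (IsMaximal G par ∨ 2 * p ≤ matchedCard par) := by
  induction p with
  | zero =>
    refine ⟨fun v => (c v).partner, fun v => (c v).target, rfl, ?_, by simp⟩
    intro v j hj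
    simp only [hpar] at hj
    cases hj
  | succ p ih =>
    obtain ⟨par, tgt, h, hpair, hp⟩ := ih
    obtain ⟨par', tgt', h', hpair', hmax, hp'⟩ := exec_phase (G := G) hinj
      (fun v => { c v with partner := par v, target := tgt v }) hid hpair
    refine ⟨par', tgt', ?_, hpair', ?_⟩
    · rw [matchSteps, exec_append, h, h']
    · rcases hp' with hp' | hp'
      · exact Or.inl (hmax hp')
      · rcases hp with hp | hp
        · exact Or.inl (hmax hp)
        · right
          change matchedCard par + 2 ≤ _ at hp'
          omega

lemma legal_matchSteps {P : Set Msg} {ids : V → ℕ} (hinj : Function.Injective ids)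
    (c : V → LocalState) (hid : ∀ v, (c v).ident = ids v) (hpar : ∀ v, (c v).partner = none)
    (h0 : ∅ ∈ P) (hP : ∀ u v, {(ids u, ids v)} ∈ P) (p : ℕ) :
    Legal G P (matchSteps p) c := by
  induction p with
  | zero => trivial
  | succ p ih =>
    refine legal_append G ih ?_
    obtain ⟨par, tgt, h, -⟩ := exec_matchSteps (G := G) hinj c hid hpar p
    rw [h]
    exact legal_phase _ hid h0 hP

end Matching

/-! ### Making the matching known to all vertices -/

/-- A vertex with a partner issues the pair of the two identifiers; a vertex that could still be
matched issues an alarm, which is a pair of equal numbers. -/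
def matchingToken (i : ℕ) (par tgt : Option ℕ) : Msg :=
  par.elim (if tgt ≠ none then {(i, i)} else ∅) fun j => {(i, j)}

/-- A step without communication that issues the tokens describing the matching. -/
def tokenStep : Step where
  msg _ := ∅
  upd s _ := { s with known := matchingToken s.ident s.partner s.target, sent := ∅ }

/-- The matching is too large or not maximal. -/
def Bad (k : ℕ) (Y : Msg) : Prop := 2 * k < Y.card ∨ ∃ p ∈ Y, p.1 = p.2

lemma Bad.mono {k : ℕ} {Y Y' : Msg} (h : Bad k Y) (hY : Y ⊆ Y') : Bad k Y' :=
  h.imp (fun h => h.trans_le (card_le_card hY)) fun ⟨p, hp, h⟩ => ⟨p, hY hp, h⟩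

/-- Up to `m` of the matching edges described by a set of tokens. -/
def selected (m : ℕ) (Y : Msg) : Msg := pick m (Y.filter fun p => p.1 < p.2)

/-- A step without communication in which the endpoints of `m` matching edges are removed. -/
def removeStep (k m : ℕ) : Step where
  msg _ := ∅
  upd s _ := { s with
    failed := Bad k s.known
    removed := (selected m s.known).image Prod.fst ∪ (selected m s.known).image Prod.snd }

section Tokens

variable {V : Type*} {G : SimpleGraph V}

lemma exists_dist_eq (hG : G.Connected) {v u : V} {d : ℕ} (h : d ≤ G.dist v u) :
    ∃ w, G.dist v w = d := by
  induction hn : G.dist v u - d generalizing u with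
  | zero => exact ⟨u, by omega⟩
  | succ n ih =>
    obtain ⟨w, -, hw⟩ := exists_adj_dist (d := G.dist v u - 1) hG
      (show G.dist u v = G.dist v u - 1 + 1 by rw [SimpleGraph.dist_comm]; omega)
    rw [SimpleGraph.dist_comm] at hw
    exact ih (u := w) (by omega) (by omega)

variable {ids : V → ℕ} {par tgt : V → Option ℕ}

lemma mem_matchingToken (hpair : IsPairing G ids par) {v : V} {p : ℕ × ℕ}
    (hp : p ∈ matchingToken (ids v) (par v) (tgt v)) :
    p = (ids v, ids v) ∧ par v = none ∧ tgt v ≠ none ∨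
      ∃ u, G.Adj v u ∧ p = (ids v, ids u) ∧ par v = some (ids u) ∧ par u = some (ids v) := by
  unfold matchingToken at hp
  rcases h : par v with _ | j
  · rw [h] at hp
    simp only [Option.elim_none] at hp
    split_ifs at hp with h'
    · left
      exact ⟨mem_singleton.1 hp, rfl, h'⟩
    · simp at hp
  · rw [h] at hp
    right
    obtain ⟨u, hu, rfl, hpu⟩ := hpair v j h
    exact ⟨u, hu, mem_singleton.1 hp, rfl, hpu⟩

lemma mem_matchingToken_of_partner {v u : V} (h : par v = some (ids u)) :
    (ids v, ids u) ∈ matchingToken (ids v) (par v) (tgt v) := by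
  simp [matchingToken, h]

end Tokens

section Removal

variable {V : Type*} [Fintype V] {G : SimpleGraph V}

/-- The partner of a matched vertex outside `Z` lies in `Z`, and passing to the partner is
injective; so at most `Z.card` matched vertices lie outside `Z`. -/
lemma matchedCard_le_of_cover {ids : V → ℕ} (hinj : Function.Injective ids) {par : V → Option ℕ}
    (hpair : IsPairing G ids par) {Z : Finset V} (hZ : G.IsVertexCover (Z : Set V)) :
    matchedCard par ≤ 2 * Z.card := by
  have h1 : (univ.filter fun v => par v ≠ none ∧ v ∉ Z).card ≤ Z.card := by
    refine (card_le_card_of_injOn (t := Z.image fun u => some (ids u)) par ?_ ?_).trans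
      card_image_le
    · intro v hv
      simp only [coe_filter, mem_univ, true_and, Set.mem_ofPred_eq] at hv
      obtain ⟨j, hj⟩ := Option.ne_none_iff_exists'.1 hv.1
      obtain ⟨u, huv, rfl, -⟩ := hpair v j hj
      rw [hj]
      refine mem_coe.2 (mem_image.2 ⟨u, ?_, rfl⟩)
      have := hZ huv
      simpa [hv.2] using this
    · intro v hv v' hv' h
      simp only [coe_filter, mem_univ, true_and, Set.mem_ofPred_eq] at hv hv'
      obtain ⟨j, hj⟩ := Option.ne_none_iff_exists'.1 hv.1
      obtain ⟨u, -, hu, hpu⟩ := hpair v j hj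
      obtain ⟨u', -, hu', hpu'⟩ := hpair v' j (h ▸ hj)
      have : u = u' := hinj (hu.trans hu'.symm)
      subst this
      exact hinj (Option.some.inj (hpu.symm.trans hpu'))
  have h2 : (univ.filter fun v => par v ≠ none) ⊆
      Z ∪ univ.filter fun v => par v ≠ none ∧ v ∉ Z := by
    intro v hv
    by_cases h : v ∈ Z <;> simp_all
  have := (card_le_card h2).trans (card_union_le _ _)
  unfold matchedCard
  omega

variable {ids : V → ℕ} {par tgt : V → Option ℕ}

/-- A ball of large radius contains an alarm or many matched vertices. -/
lemma bad_of_dist_lt (hG : G.Connected) (hinj : Function.Injective ids)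
    (hpair : IsPairing G ids par) (htgt : IsTarget G ids par tgt) {k : ℕ} {v u : V}
    (hvu : 4 * k + 1 < G.dist v u) {Y : Msg}
    (hY : ∀ w, G.dist v w ≤ 4 * k + 1 → matchingToken (ids w) (par w) (tgt w) ⊆ Y) :
    Bad k Y := by
  by_cases hdiag : ∃ p ∈ Y, p.1 = p.2
  · exact Or.inr hdiag
  push Not at hdiag
  -- For each of the `2k + 1` pairs of levels `2j`, `2j + 1` there is an edge between the two
  -- levels. In the absence of alarms one of its ends is matched. Different `j` give different
  -- vertices, hence different tokens.
  have key : ∀ j, ∃ w x, j < 2 * k + 1 → G.dist v w / 2 = j ∧ (ids w, ids x) ∈ Y := by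
    intro j
    by_cases hj : j < 2 * k + 1
    swap
    · exact ⟨v, v, fun h => absurd h hj⟩
    obtain ⟨w, hw⟩ := exists_dist_eq hG (show 2 * j + 1 ≤ G.dist v u by omega)
    obtain ⟨w', hww', hw'⟩ := exists_adj_dist hG (SimpleGraph.dist_comm.trans hw)
    rw [SimpleGraph.dist_comm] at hw'
    have hmatched : ∃ y, (y = w ∨ y = w') ∧ par y ≠ none := by
      by_contra hno
      push Not at hno
      have h1 := hno w (Or.inl rfl)
      have h2 := hno w' (Or.inr rfl)
      have h3 := (htgt w).2 w' h1 hww' h2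
      refine hdiag (ids w, ids w) (hY w (by omega) ?_) rfl
      simp [matchingToken, h1, h3]
    obtain ⟨y, hy, hpy⟩ := hmatched
    obtain ⟨i, hi⟩ := Option.ne_none_iff_exists'.1 hpy
    obtain ⟨x, -, rfl, -⟩ := hpair y i hi
    have hyd : G.dist v y / 2 = j ∧ G.dist v y ≤ 4 * k + 1 := by
      rcases hy with rfl | rfl <;> omega
    exact ⟨y, x, fun _ => ⟨hyd.1, hY y hyd.2 (mem_matchingToken_of_partner hi)⟩⟩
  choose w x hwx using key
  left
  have : (range (2 * k + 1)).card ≤ Y.card := by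
    refine card_le_card_of_injOn (fun j => (ids (w j), ids (x j))) ?_ ?_
    · intro j hj
      exact (hwx j (by simpa using hj)).2
    · intro j hj j' hj' h
      have h1 : w j = w j' := hinj (Prod.mk.inj h).1
      rw [← (hwx j (by simpa using hj)).1, ← (hwx j' (by simpa using hj')).1, h1]
  rw [card_range] at this
  omega

/-- In a maximal matching no vertex raises an alarm, and each matched vertex issues a single token,
so too many tokens mean too many matched vertices. A matching that is not maximal after all phases
is too large by `hmax`. -/
lemma lt_matchedCard_of_bad (hinj : Function.Injective ids)
    (hpair : IsPairing G ids par) (htgt : IsTarget G ids par tgt) {k : ℕ}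
    (hmax : IsMaximal G par ∨ 2 * (k + 1) ≤ matchedCard par)
    (hbad : Bad k (univ.biUnion fun v => matchingToken (ids v) (par v) (tgt v))) :
    2 * k < matchedCard par := by
  by_contra hlt
  have hmax : IsMaximal G par := hmax.resolve_right (by omega)
  have hmatched : ∀ v, ∀ p ∈ matchingToken (ids v) (par v) (tgt v), par v ≠ none ∧ p.1 ≠ p.2 := by
    intro v p hp
    rcases mem_matchingToken hpair hp with ⟨-, h1, h2⟩ | ⟨u, huv, rfl, h1, -⟩
    · obtain ⟨j, hj⟩ := Option.ne_none_iff_exists'.1 h2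
      obtain ⟨-, u, huv, hu, -⟩ := (htgt v).1 j hj
      exact absurd h1 ((hmax v u huv).resolve_right (not_not.2 hu))
    · refine ⟨by simp [h1], fun h => huv.ne (hinj h)⟩
  rcases hbad with hbad | ⟨p, hp, h⟩
  · refine hlt (hbad.trans_le ?_)
    have hsub : (univ.biUnion fun v => matchingToken (ids v) (par v) (tgt v)) ⊆
        (univ.filter fun v => par v ≠ none).image fun v => (ids v, (par v).getD 0) := by
      intro p hp
      simp only [mem_biUnion, mem_univ, true_and] at hp
      obtain ⟨v, hp⟩ := hp
      have h1 := (hmatched v p hp).1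
      rcases mem_matchingToken hpair hp with ⟨-, h, -⟩ | ⟨u, -, rfl, h, -⟩
      · exact absurd h h1
      · exact mem_image.2 ⟨v, by simpa using h1, by simp [h]⟩
    exact (card_le_card hsub).trans card_image_le
  · simp only [mem_biUnion, mem_univ, true_and] at hp
    obtain ⟨v, hp⟩ := hp
    exact (hmatched v p hp).2 h

/-- What the removal of the endpoints of `m` matching edges achieves. -/
lemma exists_removed (hinj : Function.Injective ids) (hpair : IsPairing G ids par) {k m : ℕ}
    (hmax : IsMaximal G par ∨ 2 * (k + 1) ≤ matchedCard par) {Y : Msg}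
    (hY : Y = univ.biUnion fun v => matchingToken (ids v) (par v) (tgt v)) (hgood : ¬ Bad k Y) :
    ∃ X : Finset V,
      (selected m Y).image Prod.fst ∪ (selected m Y).image Prod.snd = X.image ids ∧
      X.card ≤ 2 * m ∧
      ∀ Z : Finset V, G.IsVertexCover (Z : Set V) →
        G.IsVertexCover (X : Set V) ∨ (Z \ X).card + m ≤ Z.card := by
  have hmem : ∀ p ∈ Y, ∃ v u, G.Adj v u ∧ p = (ids v, ids u) ∧ par v = some (ids u) ∧
      par u = some (ids v) := by
    intro p hp
    have hp' := hp
    rw [hY] at hp'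
    simp only [mem_biUnion, mem_univ, true_and] at hp'
    obtain ⟨v, hv⟩ := hp'
    rcases mem_matchingToken hpair hv with ⟨rfl, -, -⟩ | ⟨u, h⟩
    · exact absurd (Or.inr ⟨_, hp, rfl⟩) hgood
    · exact ⟨v, u, h⟩
  have hselY : selected m Y ⊆ Y := (pick_subset _ _).trans (filter_subset _ _)
  have hsellt : ∀ p ∈ selected m Y, p.1 < p.2 := fun p hp =>
    (mem_filter.1 (pick_subset _ _ hp)).2
  set X : Finset V := univ.filter fun v => ids v ∈
    (selected m Y).image Prod.fst ∪ (selected m Y).image Prod.snd with hX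
  have hXids : (selected m Y).image Prod.fst ∪ (selected m Y).image Prod.snd = X.image ids := by
    ext i
    simp only [hX, mem_image, mem_filter, mem_univ, true_and]
    constructor
    · intro hi
      have : ∃ v, ids v = i := by
        simp only [mem_union, mem_image] at hi
        rcases hi with ⟨p, hp, rfl⟩ | ⟨p, hp, rfl⟩ <;>
          obtain ⟨v, u, -, rfl, -⟩ := hmem p (hselY hp)
        · exact ⟨v, rfl⟩
        · exact ⟨u, rfl⟩
      obtain ⟨v, rfl⟩ := this
      exact ⟨v, hi, rfl⟩
    · rintro ⟨v, hv, rfl⟩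
      exact hv
  have hcard : (selected m Y).card = min m (Y.filter fun p => p.1 < p.2).card := card_pick _ _
  refine ⟨X, hXids, ?_, ?_⟩
  · rw [← card_image_of_injective X hinj, ← hXids]
    refine (card_union_le _ _).trans ?_
    have h1 := card_image_le (s := selected m Y) (f := Prod.fst)
    have h2 := card_image_le (s := selected m Y) (f := Prod.snd)
    omega
  · intro Z hZ
    rcases Nat.lt_or_ge (selected m Y).card m with hlt | hge
    · left
      -- Fewer than `m` selected pairs means that the whole matching was selected; as it is maximal,
      -- its endpoints form a cover.
      have hall : selected m Y = Y.filter fun p => p.1 < p.2 :=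
        eq_of_subset_of_card_le (pick_subset _ _) (by rw [hcard] at hlt ⊢; omega)
      have hmax : IsMaximal G par := by
        refine hmax.resolve_right fun h => hgood (Or.inl ?_)
        refine lt_of_lt_of_le (by omega : 2 * k < 2 * (k + 1)) (h.trans ?_)
        refine card_le_card_of_injOn (fun v => (ids v, (par v).getD 0)) ?_
          fun v _ u _ h => hinj (Prod.mk.inj h).1
        intro v hv
        obtain ⟨j, hj⟩ := Option.ne_none_iff_exists'.1 (mem_filter.1 hv).2
        obtain ⟨u, -, rfl, -⟩ := hpair v j hj
        simp only [hj, Option.getD_some]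
        rw [hY]
        exact mem_coe.2 (mem_biUnion.2 ⟨v, mem_univ v, mem_matchingToken_of_partner hj⟩)
      have hmatched : ∀ v, par v ≠ none → v ∈ X := by
        intro v hv
        obtain ⟨j, hj⟩ := Option.ne_none_iff_exists'.1 hv
        obtain ⟨u, huv, rfl, hu⟩ := hpair v j hj
        have h1 : (ids v, ids u) ∈ Y := hY ▸
          mem_biUnion.2 ⟨v, mem_univ v, mem_matchingToken_of_partner hj⟩
        have h2 : (ids u, ids v) ∈ Y := hY ▸
          mem_biUnion.2 ⟨u, mem_univ u, mem_matchingToken_of_partner hu⟩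
        simp only [hX, mem_filter, mem_univ, true_and, hall, mem_union, mem_image]
        rcases lt_or_gt_of_ne (fun h => huv.ne (hinj h) : ids v ≠ ids u) with h | h
        · exact Or.inl ⟨_, ⟨h1, h⟩, rfl⟩
        · exact Or.inr ⟨_, ⟨h2, h⟩, rfl⟩
      intro v u huv
      exact (hmax v u huv).imp (hmatched v) (hmatched u)
    · right
      have hmem' : ∀ p ∈ selected m Y, ∃ v u, G.Adj v u ∧ p = (ids v, ids u) ∧
        par v = some (ids u) ∧ par u = some (ids v) := fun p hp => hmem p (hselY hp)
      -- Each selected edge is sent to one of its endpoints in `Z`; this is injective because the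
      -- edges are disjoint.
      have hle : (selected m Y).card ≤ (Z ∩ X).card := by
        rw [← card_image_of_injective (Z ∩ X) hinj]
        refine card_le_card_of_injOn
          (fun p => if p.1 ∈ Z.image ids then p.1 else p.2) ?_ ?_
        · intro p hp
          have hp := mem_coe.1 hp
          obtain ⟨v, u, huv, hpe, -⟩ := hmem' p hp
          have hv : v ∈ X := by
            simp only [hX, mem_filter, mem_univ, true_and]
            exact mem_union_left _ (mem_image.2 ⟨p, hp, by rw [hpe]⟩)
          have hu : u ∈ X := by
            simp only [hX, mem_filter, mem_univ, true_and]
            exact mem_union_right _ (mem_image.2 ⟨p, hp, by rw [hpe]⟩)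
          subst hpe
          simp only [hinj.mem_finset_image]
          split_ifs with h
          · exact mem_coe.2 (mem_image.2 ⟨v, mem_inter.2 ⟨h, hv⟩, rfl⟩)
          · have : u ∈ Z := by
              have := hZ huv
              simpa [h] using this
            exact mem_coe.2 (mem_image.2 ⟨u, mem_inter.2 ⟨this, hu⟩, rfl⟩)
        · intro p hp p' hp' h
          have hlt := hsellt p hp
          have hlt' := hsellt p' hp'
          obtain ⟨v, u, -, rfl, h1, h2⟩ := hmem' p hp
          obtain ⟨v', u', -, rfl, h1', h2'⟩ := hmem' p' hp'
          -- A crosswise coincidence would give both orientations of one edge, but only pairs with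
          -- increasing identifiers are selected.
          have h3 : (v = v' ∨ u = u') ∨ (v = u' ∨ u = v') := by
            simp only at h
            split_ifs at h
            · exact Or.inl (Or.inl (hinj h))
            · exact Or.inr (Or.inl (hinj h))
            · exact Or.inr (Or.inr (hinj h))
            · exact Or.inl (Or.inr (hinj h))
          simp only at hlt hlt'
          rcases h3 with (rfl | rfl) | (rfl | rfl)
          · rw [Option.some.inj (h1.symm.trans h1')]
          · rw [Option.some.inj (h2.symm.trans h2')]
          · have := Option.some.inj (h1.symm.trans h2')
            omega
          · have := Option.some.inj (h2.symm.trans h1')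
            omega
      have := card_sdiff_add_card_inter Z X
      omega

end Removal

/-! ### The removal program. -/

/-- The first part of the algorithm, which either fails or removes `m` matching edges. -/
def removalSteps (k m : ℕ) : List Step :=
  matchSteps (k + 1) ++ ([pointStep, tokenStep] ++
    (List.replicate (6 * k + 1) (floodStep 1) ++ [removeStep k m]))

lemma length_removalSteps (k m : ℕ) : (removalSteps k m).length = 8 * k + 6 := by
  simp [removalSteps, length_matchSteps]
  ring

lemma labelFree_of_mem_removalSteps {k m : ℕ} : ∀ st ∈ removalSteps k m, LabelFree st := by
  have hpoint : LabelFree pointStep := fun s x => ⟨rfl, fun I => rfl⟩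
  have hmatch : LabelFree matchStep := fun s x => ⟨rfl, fun I => rfl⟩
  have h : ∀ p, ∀ st ∈ matchSteps p, LabelFree st := by
    intro p
    induction p with
    | zero => simp [matchSteps]
    | succ p ih =>
      intro st hst
      simp only [matchSteps, List.mem_append, List.mem_cons, List.not_mem_nil, or_false] at hst
      rcases hst with hst | rfl | rfl
      · exact ih st hst
      · exact hpoint
      · exact hmatch
  intro st hst
  simp only [removalSteps, List.mem_append, List.mem_cons, List.not_mem_nil, or_false,
    List.mem_replicate] at hst
  rcases hst with hst | (rfl | rfl) | ⟨-, rfl⟩ | rfl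
  · exact h _ st hst
  · exact hpoint
  all_goals exact fun s x => ⟨rfl, fun I => rfl⟩

section

variable {V : Type*} [Fintype V] {G : SimpleGraph V}

/-- All vertices reach the same verdict. If the token set is bad, each vertex sees this: it has too
many tokens, or a complete ball of radius `4k + 1`, which is either everything or bad by itself. If
it is good, the diameter is small, everyone knows the same tokens, and the fixed choice in
`selected` gives everyone the same removed set. -/
lemma exec_removalSteps (hG : G.Connected) {ids : V → ℕ} (hinj : Function.Injective ids)
    (c : V → LocalState) (hid : ∀ v, (c v).ident = ids v) (hpar : ∀ v, (c v).partner = none)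
    (k m : ℕ) {P : Set Msg} (h0 : ∅ ∈ P) (hP : ∀ u v, {(ids u, ids v)} ∈ P) :
    Legal G P (removalSteps k m) c ∧
    (∀ v, (exec G (removalSteps k m) c v).ident = ids v) ∧
    (((∀ v, (exec G (removalSteps k m) c v).failed) ∧
        ∀ Z : Finset V, G.IsVertexCover (Z : Set V) → k < Z.card) ∨
      ((∀ v, ¬ (exec G (removalSteps k m) c v).failed) ∧ (∀ v u, G.dist v u ≤ 4 * k + 1) ∧
        ∃ X : Finset V, (∀ v, (exec G (removalSteps k m) c v).removed = X.image ids) ∧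
          X.card ≤ 2 * m ∧ ∀ Z : Finset V, G.IsVertexCover (Z : Set V) →
            G.IsVertexCover (X : Set V) ∨ (Z \ X).card + m ≤ Z.card)) := by
  obtain ⟨par, tgt₀, h1, hpair, hmax⟩ := exec_matchSteps (G := G) hinj c hid hpar (k + 1)
  set c₁ : V → LocalState := fun v => { c v with partner := par v, target := tgt₀ v } with hc₁
  obtain ⟨tgt, h2, htgt⟩ := apply_pointStep (G := G) (ids := ids) c₁ hid
  set K : V → Msg := fun v => matchingToken (ids v) (par v) (tgt v) with hK
  set c₂ : V → LocalState := fun v =>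
    { c v with partner := par v, target := tgt v, known := K v, sent := ∅ } with hc₂
  have h3 : exec G [pointStep, tokenStep] c₁ = c₂ := by
    simp only [exec, h2]
    funext v
    simp only [Step.apply, tokenStep, hc₂, hc₁, hK, hid]
  obtain ⟨kn, se, h4, hknK, -, -, -, -, hA⟩ :=
    exec_flood hG 1 c₂ K (fun v => rfl) (fun v => rfl) (6 * k + 1)
  set U := univ.biUnion K with hU
  have h5 : exec G (removalSteps k m) c = fun v => { c₂ v with
      known := kn v, sent := se v, failed := Bad k (kn v),
      removed := (selected m (kn v)).image Prod.fst ∪ (selected m (kn v)).image Prod.snd } := by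
    rw [removalSteps, exec_append, h1, exec_append, h3, exec_append, h4]
    rfl
  -- After `6k + 1` rounds with one token each, radius `4k + 1` leaves the alternative of `(6k + 2)
  -- - (4k + 1) = 2k + 1` known tokens, just enough to be bad.
  have hA' : ∀ v, Bad k (kn v) ∨ ∀ u, G.dist v u ≤ 4 * k + 1 → K u ⊆ kn v := by
    intro v
    refine (hA (4 * k + 1) (by omega) v).imp_left fun h => Or.inl ?_
    omega
  refine ⟨?_, ?_, ?_⟩
  · refine legal_append G (legal_matchSteps hinj c hid hpar h0 hP _) ?_
    rw [h1]
    refine legal_append G ⟨fun v => ?_, fun v => h0, trivial⟩ ?_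
    · simp only [pointStep]
      split_ifs
      · rw [show (c₁ v).ident = ids v from hid v]
        exact hP v v
      · exact h0
    rw [h3]
    refine legal_append G (legal_flood hG 1 c₂ K (fun v => rfl) (fun v => rfl) ?_ _)
      ⟨fun v => h0, trivial⟩
    intro x hx hcard
    rcases Nat.le_one_iff_eq_zero_or_eq_one.1 hcard with h | h
    · rw [card_eq_zero.1 h]
      exact h0
    · obtain ⟨p, rfl⟩ := card_eq_one.1 h
      have hp := hx (mem_singleton_self p)
      simp only [mem_biUnion, mem_univ, true_and] at hp
      obtain ⟨v, hp⟩ := hp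
      rcases mem_matchingToken hpair hp with ⟨rfl, -, -⟩ | ⟨u, -, rfl, -, -⟩
      · exact hP v v
      · exact hP v u
  · intro v
    rw [h5]
    exact hid v
  · rw [h5]
    by_cases hbad : Bad k U
    · left
      constructor
      · intro v
        change Bad k (kn v)
        refine (hA' v).elim id fun h => ?_
        by_cases hd : ∀ u, G.dist v u ≤ 4 * k + 1
        · exact hbad.mono (biUnion_subset.2 fun u _ => h u (hd u))
        · push Not at hd
          obtain ⟨u, hu⟩ := hd
          exact bad_of_dist_lt hG hinj hpair htgt hu h
      · intro Z hZ
        have h6 := matchedCard_le_of_cover hinj hpair hZ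
        have h7 := lt_matchedCard_of_bad hinj hpair htgt hmax hbad
        omega
    · right
      have hdist : ∀ v u, G.dist v u ≤ 4 * k + 1 := by
        intro v u
        by_contra hlt
        exact hbad (bad_of_dist_lt hG hinj hpair htgt (not_le.1 hlt)
          fun w _ => subset_biUnion_of_mem K (mem_univ w))
      have hkn : ∀ v, kn v = U := fun v => (hknK v).antisymm
        (biUnion_subset.2 fun u _ =>
          (hA' v).resolve_left (fun h => hbad (h.mono (hknK v))) u (hdist v u))
      obtain ⟨X, hX, hcard, hcov⟩ := exists_removed (m := m) hinj hpair hmax hU hbad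
      refine ⟨fun v => ?_, hdist, X, fun v => ?_, hcard, hcov⟩
      · change ¬ Bad k (kn v)
        rwa [hkn]
      · change (selected m (kn v)).image Prod.fst ∪ (selected m (kn v)).image Prod.snd = _
        rw [hkn, hX]

end

/-! ### The kernel of the remaining graph -/

section Kernel

variable {V : Type*} [Fintype V] {G : SimpleGraph V}

/-- The degree of a vertex in the graph that remains when the vertices in `X` are removed. -/
def resDeg (G : SimpleGraph V) (X : Finset V) (v : V) : ℕ :=
  (univ.filter fun u => G.Adj v u ∧ u ∉ X).card

/-- The kernel of the graph without `X`: a loop at every vertex of degree more than `r`, and all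
edges (in both directions) between the other vertices. -/
def kernel (G : SimpleGraph V) (X : Finset V) (r : ℕ) : Finset (V × V) :=
  univ.filter fun p => p.1 ∉ X ∧ p.2 ∉ X ∧
    (p.1 = p.2 ∧ r < resDeg G X p.1 ∨
      G.Adj p.1 p.2 ∧ resDeg G X p.1 ≤ r ∧ resDeg G X p.2 ≤ r)

lemma mem_kernel {X : Finset V} {r : ℕ} {v u : V} : (v, u) ∈ kernel G X r ↔
    v ∉ X ∧ u ∉ X ∧ (v = u ∧ r < resDeg G X v ∨
      G.Adj v u ∧ resDeg G X v ≤ r ∧ resDeg G X u ≤ r) := by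
  simp [kernel]

/-- Buss's count: a covering vertex accounts for its loop, or for at most `r` edges in two
orientations. Arbitrary subsets `E` are allowed so that `T + 1` pairs of an oversized kernel can
certify that no small cover exists. -/
lemma card_le_of_subset_kernel {X : Finset V} {r : ℕ} (hr : 1 ≤ r) {E : Finset (V × V)}
    (hE : E ⊆ kernel G X r) {Z : Finset V} (hZ : Z.card ≤ r)
    (hcov : ∀ p ∈ E, p.1 ∈ Z ∨ p.2 ∈ Z) :
    E.card ≤ min (2 * r ^ 2) (Fintype.card V ^ 2) := by
  refine le_min ?_ ((card_le_univ E).trans (by rw [Fintype.card_prod, sq]))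
  let F : V → Finset (V × V) := fun a => if r < resDeg G X a then {(a, a)} else
    (univ.filter fun u => G.Adj a u ∧ u ∉ X).image (fun u => (a, u)) ∪
      (univ.filter fun u => G.Adj a u ∧ u ∉ X).image (fun u => (u, a))
  have hF : ∀ a ∈ Z, (F a).card ≤ 2 * r := by
    intro a _
    simp only [F]
    split_ifs with h
    · rw [card_singleton]; omega
    · refine (card_union_le _ _).trans ?_
      have h1 := card_image_le (s := univ.filter fun u => G.Adj a u ∧ u ∉ X)
        (f := fun u => (a, u))
      have h2 := card_image_le (s := univ.filter fun u => G.Adj a u ∧ u ∉ X)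
        (f := fun u => (u, a))
      unfold resDeg at h
      omega
  have hsub : E ⊆ Z.biUnion F := by
    rintro ⟨v, u⟩ hp
    obtain ⟨hv, hu, h⟩ := mem_kernel.1 (hE hp)
    rw [mem_biUnion]
    rcases h with ⟨rfl, h⟩ | ⟨huv, h1, h2⟩
    · exact ⟨v, by simpa using hcov _ hp, by simp [F, h]⟩
    · rcases hcov _ hp with h | h
      · exact ⟨v, h, by simp [F, not_lt.2 h1, huv, hu]⟩
      · exact ⟨u, h, by simp [F, not_lt.2 h2, huv.symm, hv]⟩
  calc E.card ≤ (Z.biUnion F).card := card_le_card hsub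
    _ ≤ Z.card * (2 * r) := card_biUnion_le_card_mul _ _ _ hF
    _ ≤ r * (2 * r) := Nat.mul_le_mul_right _ hZ
    _ = 2 * r ^ 2 := by ring

/-- If `X` is a cover, the kernel is empty. Otherwise `Z \ X` has at most `r` vertices, and it
contains every vertex with a loop, since it would otherwise contain all of that vertex's more than
`r` remaining neighbours. -/
lemma exists_kernel_cover {X : Finset V} {k m r : ℕ} (hk : k ≤ m + r) {Z : Finset V}
    (hZ : G.IsVertexCover (Z : Set V)) (hZk : Z.card ≤ k)
    (h : G.IsVertexCover (X : Set V) ∨ (Z \ X).card + m ≤ Z.card) :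
    ∃ Z' : Finset V, Z'.card ≤ r ∧ ∀ p ∈ kernel G X r, p.1 ∈ Z' ∨ p.2 ∈ Z' := by
  rcases h with h | h
  · refine ⟨∅, by simp, ?_⟩
    rintro ⟨v, u⟩ hp
    obtain ⟨hv, hu, ⟨rfl, hdeg⟩ | ⟨huv, -, -⟩⟩ := mem_kernel.1 hp
    · obtain ⟨w, hw⟩ := card_pos.1 (Nat.zero_lt_of_lt hdeg)
      simp only [mem_filter, mem_univ, true_and] at hw
      have := h hw.1
      simp [hv, hw.2] at this
    · have := h huv
      simp [hv, hu] at this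
  · refine ⟨Z \ X, by omega, ?_⟩
    rintro ⟨v, u⟩ hp
    obtain ⟨hv, hu, ⟨rfl, hdeg⟩ | ⟨huv, -, -⟩⟩ := mem_kernel.1 hp
    · left
      rw [mem_sdiff]
      refine ⟨?_, hv⟩
      by_contra hvZ
      have hsub : (univ.filter fun u => G.Adj v u ∧ u ∉ X) ⊆ Z \ X := by
        intro w hw
        simp only [mem_filter, mem_univ, true_and] at hw
        have := hZ hw.1
        simp only [mem_coe, hvZ, false_or] at this
        exact mem_sdiff.2 ⟨this, hw.2⟩
      have := card_le_card hsub
      unfold resDeg at hdeg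
      omega
    · have := hZ huv
      simp only [mem_sdiff, hv, hu, not_false_eq_true, and_true]
      simpa using this

/-- The label set `S` covers the set `Y` of pairs of labels. -/
def Covers (r : ℕ) (Y : Msg) (S : Finset ℕ) : Prop :=
  S.card ≤ r ∧ ∀ p ∈ Y, p.1 ∈ S ∨ p.2 ∈ S

/-- The pairs of labels of the kernel. -/
def kernelTokens (G : SimpleGraph V) (X : Finset V) (r : ℕ) (lab : V → ℕ) : Msg :=
  (kernel G X r).image fun p => (lab p.1, lab p.2)

/-- The vertices of the kernel with labels in `S`. -/
def kernelVertices (G : SimpleGraph V) (X : Finset V) (r : ℕ) (lab : V → ℕ) (S : Finset ℕ) :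
    Finset V :=
  univ.filter fun v => (∃ u, (v, u) ∈ kernel G X r) ∧ lab v ∈ S

/-- No injectivity of the labels is needed: a collision can only put more vertices into the cover,
so it threatens the size bound but not the covering property. -/
lemma isVertexCover_union_kernelVertices {X : Finset V} {r : ℕ} {lab : V → ℕ} {S : Finset ℕ}
    (hS : Covers r (kernelTokens G X r lab) S) :
    G.IsVertexCover (X ∪ kernelVertices G X r lab S : Finset V) := by
  have key : ∀ v u, (v, u) ∈ kernel G X r → lab v ∈ S ∨ lab u ∈ S := fun v u h =>
    hS.2 (lab v, lab u) (mem_image.2 ⟨(v, u), h, rfl⟩)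
  intro v u huv
  simp only [mem_coe, mem_union, kernelVertices, mem_filter, mem_univ, true_and]
  by_cases hv : v ∈ X
  · exact Or.inl (Or.inl hv)
  by_cases hu : u ∈ X
  · exact Or.inr (Or.inl hu)
  by_cases hdv : r < resDeg G X v
  · have h : (v, v) ∈ kernel G X r := mem_kernel.2 ⟨hv, hv, Or.inl ⟨rfl, hdv⟩⟩
    exact Or.inl (Or.inr ⟨⟨v, h⟩, (key _ _ h).elim id id⟩)
  by_cases hdu : r < resDeg G X u
  · have h : (u, u) ∈ kernel G X r := mem_kernel.2 ⟨hu, hu, Or.inl ⟨rfl, hdu⟩⟩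
    exact Or.inr (Or.inr ⟨⟨u, h⟩, (key _ _ h).elim id id⟩)
  have h1 : (v, u) ∈ kernel G X r :=
    mem_kernel.2 ⟨hv, hu, Or.inr ⟨huv, not_lt.1 hdv, not_lt.1 hdu⟩⟩
  have h2 : (u, v) ∈ kernel G X r :=
    mem_kernel.2 ⟨hu, hv, Or.inr ⟨huv.symm, not_lt.1 hdu, not_lt.1 hdv⟩⟩
  exact (key _ _ h1).imp (fun h => Or.inr ⟨⟨u, h1⟩, h⟩) fun h => Or.inr ⟨⟨v, h2⟩, h⟩

/-- The labels need to be distinct only on a small set of vertices. -/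
lemma exists_witness (X : Finset V) {r T : ℕ} (hr : 1 ≤ r)
    (hT : T = min (2 * r ^ 2) (Fintype.card V ^ 2)) :
    ∃ W : Finset V, W.card ≤ 2 * (T + 1) ∧ ∀ lab : V → ℕ, Set.InjOn lab W →
      ((T < (kernelTokens G X r lab).card ∨ ¬ ∃ S, Covers r (kernelTokens G X r lab) S) ∧
        ¬ ∃ Z : Finset V, Z.card ≤ r ∧ ∀ p ∈ kernel G X r, p.1 ∈ Z ∨ p.2 ∈ Z) ∨
      ((kernelTokens G X r lab).card ≤ T ∧ (∃ S, Covers r (kernelTokens G X r lab) S) ∧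
        ∀ S, Covers r (kernelTokens G X r lab) S → (kernelVertices G X r lab S).card ≤ r) := by
  have hWcard : ∀ E : Finset (V × V), E.card ≤ T + 1 →
      (E.image Prod.fst ∪ E.image Prod.snd).card ≤ 2 * (T + 1) := by
    intro E hE
    have h1 := card_image_le (s := E) (f := Prod.fst)
    have h2 := card_image_le (s := E) (f := Prod.snd)
    have h3 := card_union_le (E.image Prod.fst) (E.image Prod.snd)
    omega
  rcases Nat.lt_or_ge T (kernel G X r).card with hlt | hle
  -- An oversized kernel may involve many vertices, but `T + 1` of its pairs already rule out a
  -- cover of size `r`. With labels distinct on their endpoints, a label cover would pull back to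
  -- such a cover.
  · obtain ⟨E, hE, hcard⟩ := exists_subset_card_eq (Nat.succ_le_of_lt hlt)
    have hno : ¬ ∃ Z : Finset V, Z.card ≤ r ∧ ∀ p ∈ E, p.1 ∈ Z ∨ p.2 ∈ Z := by
      rintro ⟨Z, hZ, hcov⟩
      have := card_le_of_subset_kernel hr hE hZ hcov
      omega
    refine ⟨E.image Prod.fst ∪ E.image Prod.snd, hWcard E hcard.le, fun lab hinj => Or.inl ⟨?_, ?_⟩⟩
    · right
      rintro ⟨S, hS⟩
      refine hno ⟨(E.image Prod.fst ∪ E.image Prod.snd).filter fun v => lab v ∈ S, ?_, ?_⟩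
      · refine (card_le_card_of_injOn (t := S) lab ?_ ?_).trans hS.1
        · intro v hv
          exact (mem_filter.1 hv).2
        · exact hinj.mono fun v hv => (mem_filter.1 hv).1
      · intro p hp
        simp only [mem_filter]
        refine (hS.2 (lab p.1, lab p.2) (mem_image.2 ⟨p, hE hp, rfl⟩)).imp (fun h => ⟨?_, h⟩)
          fun h => ⟨?_, h⟩
        · exact mem_union_left _ (mem_image_of_mem _ hp)
        · exact mem_union_right _ (mem_image_of_mem _ hp)
    · rintro ⟨Z, hZ, hcov⟩
      exact hno ⟨Z, hZ, fun p hp => hcov p (hE hp)⟩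
  · refine ⟨_, hWcard (kernel G X r) (by omega), fun lab hinj => ?_⟩
    by_cases hS : ∃ S, Covers r (kernelTokens G X r lab) S
    · refine Or.inr ⟨card_image_le.trans hle, hS, fun S hS => ?_⟩
      refine (card_le_card_of_injOn (t := S) lab ?_ ?_).trans hS.1
      · intro v hv
        exact (mem_filter.1 hv).2.2
      · refine hinj.mono fun v hv => ?_
        obtain ⟨u, hu⟩ := (mem_filter.1 hv).2.1
        exact mem_union_left _ (mem_image_of_mem Prod.fst hu)
    · refine Or.inl ⟨Or.inr hS, ?_⟩
      rintro ⟨Z, hZ, hcov⟩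
      refine hS ⟨Z.image lab, card_image_le.trans hZ, ?_⟩
      intro p hp
      obtain ⟨e, he, rfl⟩ := mem_image.1 hp
      exact (hcov e he).imp (mem_image_of_mem lab) (mem_image_of_mem lab)

end Kernel

/-! ### The complete program and its output. -/

/-- Every vertex learns its degree in the remaining graph. -/
def degreeStep : Step where
  msg s := if s.ident ∈ s.removed then ∅ else {(s.ident, s.ident)}
  upd s I := { s with hdeg := I.card }

/-- The tokens of a vertex in the kernel, computed from the labels of its neighbours of small
degree. -/
def kernelOwn (r : ℕ) (s : LocalState) (I : Msg) : Msg :=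
  if s.ident ∈ s.removed then ∅ else
    if r < s.hdeg then {(s.lab, s.lab)} else I.image fun p => (s.lab, p.2)

/-- Every vertex learns its incident edges of the kernel. -/
def kernelStep (r : ℕ) : Step where
  msg s := if s.ident ∈ s.removed ∨ r < s.hdeg then ∅ else {(s.ident, s.lab)}
  upd s I := { s with own := kernelOwn r s I, known := kernelOwn r s I, sent := ∅ }

/-- The whole program. -/
def coverSteps (k m r q T : ℕ) : List Step :=
  removalSteps k m ++ ([degreeStep, kernelStep r] ++
    List.replicate (4 * k + 1 + T / q) (floodStep q))

lemma length_coverSteps (k m r q T : ℕ) :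
    (coverSteps k m r q T).length = 12 * k + 9 + T / q := by
  simp [coverSteps, length_removalSteps]
  ring

/-- A label set that covers `Y`, if there is one. -/
def labelCover (r : ℕ) (Y : Msg) : Finset ℕ :=
  if h : ∃ S, Covers r Y S then h.choose else ∅

lemma covers_labelCover {r : ℕ} {Y : Msg} (h : ∃ S, Covers r Y S) :
    Covers r Y (labelCover r Y) := by
  rw [labelCover, dif_pos h]
  exact h.choose_spec

/-- The final answer of a vertex. -/
def output (r T : ℕ) (s : LocalState) : Answer :=
  if s.failed ∨ T < s.known.card ∨ ¬ ∃ S, Covers r s.known S then .noSolution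
  else if s.ident ∈ s.removed ∨ (s.own.Nonempty ∧ s.lab ∈ labelCover r s.known) then .inCover
  else .notInCover

/-- The state in which a vertex starts. -/
def startState (i l : ℕ) : LocalState where
  ident := i
  lab := l
  partner := none
  target := none
  own := ∅
  known := ∅
  sent := ∅
  removed := ∅
  hdeg := 0
  failed := False

section

variable {V : Type*} [Fintype V] {G : SimpleGraph V}

/-- Degrees are counted with identifiers, so label collisions cannot distort them. The shape of the
tokens is stated separately, without reference to `X`, because message sizes must also be bounded in
runs where the first part has failed. -/
lemma exec_degreeStep_kernelStep {ids : V → ℕ} (hinj : Function.Injective ids) {lab : V → ℕ}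
    (r : ℕ) (c : V → LocalState) (hid : ∀ v, (c v).ident = ids v) (hlab : ∀ v, (c v).lab = lab v)
    {P : Set Msg} (h0 : ∅ ∈ P) (hP : ∀ u v, {(ids u, ids v)} ∈ P)
    (hP' : ∀ v, {(ids v, lab v)} ∈ P) :
    Legal G P [degreeStep, kernelStep r] c ∧ ∃ (D : V → ℕ) (K : V → Msg),
      exec G [degreeStep, kernelStep r] c = (fun v => { c v with
        hdeg := D v, own := K v, known := K v, sent := ∅ }) ∧
      (∀ v, ∀ p ∈ K v, ∃ u, p = (lab v, lab u)) ∧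
      ∀ X : Finset V, (∀ v, (c v).removed = X.image ids) →
        ∀ v p, p ∈ K v ↔ ∃ u, (v, u) ∈ kernel G X r ∧ p = (lab v, lab u) := by
  set D : V → ℕ := fun v => (gather G (fun u => degreeStep.msg (c u)) v).card with hD
  set c₁ : V → LocalState := fun v => { c v with hdeg := D v } with hc₁
  have h1 : degreeStep.apply G c = c₁ := rfl
  set J : V → Msg := fun v => gather G (fun u => (kernelStep r).msg (c₁ u)) v with hJ
  have hJmem : ∀ v a b, (a, b) ∈ J v ↔ ∃ u, G.Adj v u ∧ ¬ (ids u ∈ (c u).removed ∨ r < D u) ∧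
      ids u = a ∧ lab u = b := by
    intro v a b
    rw [hJ, mem_gather]
    refine exists_congr fun u => and_congr_right fun _ => ?_
    simp only [kernelStep, hc₁, hid, hlab]
    split_ifs with h
    · simp [h]
    · simp only [mem_singleton, Prod.mk.injEq, h, not_false_eq_true, true_and]
      constructor
      · rintro ⟨rfl, rfl⟩; exact ⟨rfl, rfl⟩
      · rintro ⟨rfl, rfl⟩; exact ⟨rfl, rfl⟩
  refine ⟨⟨fun v => ?_, fun v => ?_, trivial⟩, D, fun v => kernelOwn r (c₁ v) (J v), rfl, ?_, ?_⟩
  · simp only [degreeStep]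
    split_ifs
    · exact h0
    · rw [hid]; exact hP v v
  · rw [h1]
    simp only [kernelStep]
    split_ifs
    · exact h0
    · simp only [hc₁, hid, hlab]; exact hP' v
  · intro v p hp
    simp only [kernelOwn] at hp
    split_ifs at hp
    · simp at hp
    · exact ⟨v, by simpa [hc₁, hlab] using hp⟩
    · obtain ⟨⟨a, b⟩, hab, rfl⟩ := mem_image.1 hp
      obtain ⟨u, -, -, -, rfl⟩ := (hJmem v a b).1 hab
      exact ⟨u, by simp [hc₁, hlab]⟩
  · intro X hX v p
    have hrem : ∀ u, ids u ∈ (c u).removed ↔ u ∈ X := fun u => by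
      rw [hX, hinj.mem_finset_image]
    have hDeg : ∀ u, D u = resDeg G X u := by
      intro u
      rw [resDeg, ← card_image_of_injective _ (f := fun w => (ids w, ids w))
        (fun a b h => hinj (Prod.mk.inj h).1)]
      simp only [hD]
      congr 1
      ext q
      simp only [mem_gather, mem_image, mem_filter, mem_univ, true_and, degreeStep, hid, hrem]
      refine exists_congr fun w => ?_
      by_cases hw : w ∈ X
      · simp [hw]
      · simp [hw, eq_comm]
    simp only [kernelOwn, hc₁, hid, hlab, hrem, hDeg]
    by_cases hv : v ∈ X
    · simp [hv, mem_kernel]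
    by_cases hd : r < resDeg G X v
    · simp only [hv, hd, if_false, if_true, mem_singleton]
      constructor
      · rintro rfl
        exact ⟨v, mem_kernel.2 ⟨hv, hv, Or.inl ⟨rfl, hd⟩⟩, rfl⟩
      · rintro ⟨u, hu, rfl⟩
        rcases (mem_kernel.1 hu).2.2 with ⟨rfl, -⟩ | ⟨-, h, -⟩
        · rfl
        · omega
    · simp only [hv, hd, if_false, mem_image]
      constructor
      · rintro ⟨⟨a, b⟩, hab, rfl⟩
        obtain ⟨u, huv, h, rfl, rfl⟩ := (hJmem v a b).1 hab
        rw [hrem, hDeg] at h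
        push Not at h
        exact ⟨u, mem_kernel.2 ⟨hv, h.1, Or.inr ⟨huv, not_lt.1 hd, h.2⟩⟩, rfl⟩
      · rintro ⟨u, hu, rfl⟩
        rcases mem_kernel.1 hu with ⟨-, h1, ⟨rfl, h⟩ | ⟨huv, -, h⟩⟩
        · omega
        · refine ⟨(ids u, lab u), (hJmem v _ _).2 ⟨u, huv, ?_, rfl, rfl⟩, rfl⟩
          rw [hrem, hDeg]
          push Not
          exact ⟨h1, h⟩

/-- The labels after the first part are the initial labels. -/
lemma exec_removalSteps_start (ids lab : V → ℕ) (k m : ℕ) :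
    exec G (removalSteps k m) (fun v => startState (ids v) (lab v)) =
      fun v => { exec G (removalSteps k m) (fun v => startState (ids v) 0) v with lab := lab v } :=
  exec_labelFree G labelFree_of_mem_removalSteps (fun v => startState (ids v) 0) lab

lemma legal_coverSteps (hG : G.Connected) {ids : V → ℕ} (hinj : Function.Injective ids)
    (lab : V → ℕ) (k m r q T : ℕ) {P : Set Msg} (h0 : ∅ ∈ P) (hP : ∀ u v, {(ids u, ids v)} ∈ P)
    (hP' : ∀ v, {(ids v, lab v)} ∈ P)
    (hPq : ∀ x : Msg, x.card ≤ q → (∀ p ∈ x, ∃ u v, p = (lab u, lab v)) → x ∈ P) :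
    Legal G P (coverSteps k m r q T) fun v => startState (ids v) (lab v) := by
  obtain ⟨h1, h2, -⟩ := exec_removalSteps hG hinj (fun v => startState (ids v) (lab v))
    (fun _ => rfl) (fun _ => rfl) k m h0 hP
  refine legal_append G h1 ?_
  obtain ⟨h3, D, K, h4, hK, -⟩ := exec_degreeStep_kernelStep (G := G) hinj (lab := lab) r _ h2
    (fun v => by rw [exec_removalSteps_start]) h0 hP hP'
  refine legal_append G h3 ?_
  rw [h4]
  refine legal_flood hG q _ K (fun _ => rfl) (fun _ => rfl) (fun x hx hc => hPq x hc ?_) _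
  intro p hp
  obtain ⟨v, -, hv⟩ := mem_biUnion.1 (hx hp)
  obtain ⟨u, rfl⟩ := hK v p hv
  exact ⟨v, u, rfl⟩

/-- The answers of the program are correct whenever the labels are distinct on a small set. -/
lemma output_coverSteps (hG : G.Connected) {ids : V → ℕ} (hinj : Function.Injective ids)
    {k m r q T : ℕ} (hk : k ≤ m + r) (hr : 1 ≤ r) (hq : 1 ≤ q)
    (hT : T = min (2 * r ^ 2) (Fintype.card V ^ 2)) :
    ∃ W : Finset V, W.card ≤ 2 * (T + 1) ∧ ∀ lab : V → ℕ, Set.InjOn lab W →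
      ((∀ v, output r T (exec G (coverSteps k m r q T) (fun v => startState (ids v) (lab v)) v)
          = .noSolution) ∧ ∀ Z : Finset V, G.IsVertexCover (Z : Set V) → k < Z.card) ∨
      ∃ C : Finset V, G.IsVertexCover (C : Set V) ∧ C.card ≤ 2 * m + r ∧
        ∀ v, output r T (exec G (coverSteps k m r q T) (fun v => startState (ids v) (lab v)) v)
          = if v ∈ C then .inCover else .notInCover := by
  -- The first part is run with all labels `0`; by label independence its `X` serves for every
  -- labelling, so `W` can be chosen before `lab`.
  obtain ⟨-, h2, h3⟩ := exec_removalSteps hG hinj (fun v => startState (ids v) 0)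
    (fun _ => rfl) (fun _ => rfl) k m (P := Set.univ) trivial (fun _ _ => trivial)
  set c₁ := exec G (removalSteps k m) (fun v => startState (ids v) 0) with hc₁
  have hex : ∀ lab : V → ℕ, ∃ (D : V → ℕ) (K kn se : V → Msg),
      exec G (coverSteps k m r q T) (fun v => startState (ids v) (lab v)) = (fun v => { c₁ v with
        lab := lab v, hdeg := D v, own := K v, known := kn v, sent := se v }) ∧
      (∀ X : Finset V, (∀ v, (c₁ v).removed = X.image ids) →
        ∀ v p, p ∈ K v ↔ ∃ u, (v, u) ∈ kernel G X r ∧ p = (lab v, lab u)) ∧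
      (∀ v, kn v ⊆ univ.biUnion K) ∧
      ∀ v, T < (kn v).card ∨ ∀ u, G.dist v u ≤ 4 * k + 1 → K u ⊆ kn v := by
    intro lab
    obtain ⟨-, D, K, h4, -, hK⟩ := exec_degreeStep_kernelStep (G := G) hinj (lab := lab) r
      (fun v => { c₁ v with lab := lab v }) h2 (fun v => rfl) (P := Set.univ) trivial
      (fun _ _ => trivial) (fun _ => trivial)
    obtain ⟨kn, se, h5, hkn, -, -, -, -, hA⟩ := exec_flood hG q
      (fun v => { c₁ v with lab := lab v, hdeg := D v, own := K v, known := K v, sent := ∅ }) K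
      (fun _ => rfl) (fun _ => rfl) (4 * k + 1 + T / q)
    refine ⟨D, K, kn, se, ?_, hK, hkn, fun v => ?_⟩
    · rw [coverSteps, exec_append, exec_removalSteps_start, exec_append, h4, h5]
    · refine (hA (4 * k + 1) (Nat.le_add_right _ _) v).imp_left fun h => ?_
      -- The flooding time leaves the alternative of `q * (T / q + 1) > T` known tokens.
      rw [add_assoc (4 * k + 1), Nat.add_sub_cancel_left] at h
      exact (Nat.lt_mul_div_succ T hq).trans_le h
  rcases h3 with ⟨hfail, hno⟩ | ⟨hfail, hdist, X, hX, hXcard, hXcov⟩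
  · refine ⟨∅, by simp, fun lab _ => Or.inl ⟨fun v => ?_, hno⟩⟩
    obtain ⟨D, K, kn, se, h, -⟩ := hex lab
    rw [h, output, if_pos (Or.inl (hfail v))]
  · obtain ⟨W, hW, hWit⟩ := exists_witness (G := G) X hr hT
    refine ⟨W, hW, fun lab hlab => ?_⟩
    obtain ⟨D, K, kn, se, h, hK, hknK, hA⟩ := hex lab
    have hKmem := hK X hX
    have hU : univ.biUnion K = kernelTokens G X r lab := by
      ext p
      simp only [mem_biUnion, mem_univ, true_and, hKmem, kernelTokens, mem_image, Prod.exists]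
      refine exists_congr fun v => exists_congr fun u => and_congr_right fun _ => eq_comm
    rw [hU] at hknK
    have hA' : ∀ v, T < (kn v).card ∨ kn v = kernelTokens G X r lab := fun v =>
      (hA v).imp_right fun h => (hknK v).antisymm
        (hU ▸ biUnion_subset.2 fun u _ => h u (hdist v u))
    simp only [h]
    rcases hWit lab hlab with ⟨hrej, hnocov⟩ | ⟨hcard, hS, hsmall⟩
    · refine Or.inl ⟨fun v => ?_, fun Z hZ => ?_⟩
      · rw [output, if_pos]
        right
        rcases hA' v with h | h
        · exact Or.inl h
        · simp only [h]
          exact hrej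
      · by_contra hlt
        exact hnocov (exists_kernel_cover hk hZ (not_lt.1 hlt) (hXcov Z hZ))
    · have hkn : ∀ v, kn v = kernelTokens G X r lab := fun v =>
        (hA' v).resolve_left (by have := card_le_card (hknK v); omega)
      set S := labelCover r (kernelTokens G X r lab) with hSdef
      have hScov : Covers r (kernelTokens G X r lab) S := covers_labelCover hS
      refine Or.inr ⟨X ∪ kernelVertices G X r lab S, isVertexCover_union_kernelVertices hScov,
        (card_union_le _ _).trans (Nat.add_le_add hXcard (hsmall S hScov)), fun v => ?_⟩
      have hgood : ¬ ((c₁ v).failed ∨ T < (kernelTokens G X r lab).card ∨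
          ¬ ∃ S, Covers r (kernelTokens G X r lab) S) := by
        push Not
        exact ⟨hfail v, hcard, hS⟩
      have hown : (K v).Nonempty ↔ ∃ u, (v, u) ∈ kernel G X r := by
        constructor
        · rintro ⟨p, hp⟩
          obtain ⟨u, hu, -⟩ := (hKmem v p).1 hp
          exact ⟨u, hu⟩
        · rintro ⟨u, hu⟩
          exact ⟨_, (hKmem v _).2 ⟨u, hu, rfl⟩⟩
      simp only [output, hkn, if_neg hgood, h2, hX, hinj.mem_finset_image, hown, mem_union,
        kernelVertices, mem_filter, mem_univ, true_and, hSdef]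

end

/-! ### The CONGEST algorithm -/

/-- The messages used in networks with `n` vertices. -/
def Allowed (κ : ℕ) (w q : ℕ → ℕ) (n : ℕ) : Set Msg :=
  Small ((κ + 1) * n.size) 1 ∪ Small (w n) (q n)

lemma one_le_size {n : ℕ} (hn : 1 ≤ n) : 1 ≤ n.size := Nat.size_pos.2 hn

/-- Each of the two kinds of messages has at most `2 ^ ((2κ + 3) * n.size)` members; their union
costs one more bit, absorbed by `1 ≤ n.size`. -/
lemma exists_codes (κ : ℕ) (w q : ℕ → ℕ)
    (hw : ∀ n, 1 ≤ n → (2 * w n + 1) * q n ≤ (2 * κ + 3) * n.size) :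
    ∃ (enc : ℕ → Msg → List Bool) (dec : ℕ → List Bool → Msg), ∀ n, 1 ≤ n →
      (∀ x ∈ Allowed κ w q n, dec n (enc n x) = x) ∧
      ∀ x ∈ Allowed κ w q n, (enc n x).length ≤ (2 * κ + 4) * n.size := by
  have key : ∀ n, ∃ (enc : Msg → List Bool) (dec : List Bool → Msg), 1 ≤ n →
      (∀ x ∈ Allowed κ w q n, dec (enc x) = x) ∧
      ∀ x ∈ Allowed κ w q n, (enc x).length ≤ (2 * κ + 4) * n.size := by
    intro n
    by_cases hn : 1 ≤ n
    swap
    · exact ⟨fun _ => [], fun _ => ∅, fun h => absurd h hn⟩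
    have hs := one_le_size hn
    obtain ⟨hf₁, hc₁⟩ := finite_small_and_ncard_le ((κ + 1) * n.size) 1
    obtain ⟨hf₂, hc₂⟩ := finite_small_and_ncard_le (w n) (q n)
    have hcard : (Allowed κ w q n).ncard ≤ 2 ^ ((2 * κ + 4) * n.size) := by
      refine (Set.ncard_union_le _ _).trans ((Nat.add_le_add hc₁ hc₂).trans ?_)
      have h1 : 2 ^ ((2 * ((κ + 1) * n.size) + 1) * 1) ≤ 2 ^ ((2 * κ + 3) * n.size) :=
        Nat.pow_le_pow_right two_pos (by nlinarith)
      have h2 : 2 ^ ((2 * w n + 1) * q n) ≤ 2 ^ ((2 * κ + 3) * n.size) :=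
        Nat.pow_le_pow_right two_pos (hw n hn)
      calc _ ≤ 2 ^ ((2 * κ + 3) * n.size + 1) := by rw [pow_succ]; omega
        _ ≤ _ := Nat.pow_le_pow_right two_pos (by nlinarith)
    obtain ⟨enc, dec, h1, h2⟩ := exists_code (hf₁.union hf₂) hcard
    exact ⟨enc, dec, fun _ => ⟨h1, h2⟩⟩
  choose enc dec h using key
  exact ⟨enc, dec, h⟩

/-- The bound on the number of tokens. -/
def tokenBound (r n : ℕ) : ℕ := min (2 * r ^ 2) (n ^ 2)

/-- The algorithm for the parameterized vertex cover problem, with labels `lab` and `q n` tokens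
per message. -/
def coverAlgorithm (k m r : ℕ) (coins : ℕ → ℕ) (lab : (n : ℕ) → ℕ → (Fin (coins n) → Bool) → ℕ)
    (q : ℕ → ℕ) (enc : ℕ → Msg → List Bool) (dec : ℕ → List Bool → Msg) : Algorithm :=
  toAlgorithm coins (fun n i x => startState i (lab n i x))
    (fun n => coverSteps k m r (q n) (tokenBound r n)) (fun n => output r (tokenBound r n)) enc dec

section

variable {κ k m r : ℕ} {coins : ℕ → ℕ} {lab : (n : ℕ) → ℕ → (Fin (coins n) → Bool) → ℕ}
  {q w : ℕ → ℕ} {enc : ℕ → Msg → List Bool} {dec : ℕ → List Bool → Msg}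
  {V : Type*} [Fintype V] (N : Network V)

/-- Bandwidth and running time hold for all coin tosses, and correctness is reduced to distinct
labels on a set `W` quantified before `ω`, as the union bound requires. -/
lemma coverAlgorithm_spec (hk : k ≤ m + r) (hr : 1 ≤ r) (hq : ∀ n, 1 ≤ q n)
    (hlab : ∀ n i x, i < 2 ^ (κ * n.size) → lab n i x < 2 ^ w n)
    (hw : ∀ n, w n ≤ (κ + 1) * n.size)
    (hcode : ∀ n, 1 ≤ n → (∀ x ∈ Allowed κ w q n, dec n (enc n x) = x) ∧
      ∀ x ∈ Allowed κ w q n, (enc n x).length ≤ (2 * κ + 4) * n.size)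
    (hN : N.ShortIdents κ) :
    (∀ ω : (coverAlgorithm k m r coins lab q enc dec).Coins V,
      (coverAlgorithm k m r coins lab q enc dec).RespectsBandwidth N ω (2 * κ + 4) ∧
      ∀ R : ℝ, 12 * k + 9 + ((tokenBound r (Fintype.card V) / q (Fintype.card V) : ℕ) : ℝ) ≤ R →
        (coverAlgorithm k m r coins lab q enc dec).HaltsWithin N ω R) ∧
    ∃ W : Finset V, W.card ≤ 2 * (tokenBound r (Fintype.card V) + 1) ∧
      ∀ ω : (coverAlgorithm k m r coins lab q enc dec).Coins V,
        Set.InjOn (fun v => lab (Fintype.card V) (N.ident v) (ω v)) W →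
        ∀ α : ℝ, 2 * m + r ≤ α * k →
          (coverAlgorithm k m r coins lab q enc dec).Approximates N ω α k := by
  have := N.connected.nonempty
  set n := Fintype.card V with hn
  have hn1 : 1 ≤ n := Fintype.card_pos
  obtain ⟨hdec, hlen⟩ := hcode n hn1
  have hid : ∀ v, N.ident v < 2 ^ (κ * n.size) := fun v => Nat.size_le.1 (hN v)
  have hid' : ∀ v, N.ident v < 2 ^ ((κ + 1) * n.size) := fun v => (hid v).trans_le
    (Nat.pow_le_pow_right two_pos (Nat.mul_le_mul_right _ (Nat.le_succ κ)))
  have hlab' : ∀ v x, lab n (N.ident v) x < 2 ^ ((κ + 1) * n.size) := fun v x =>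
    (hlab n _ x (hid v)).trans_le (Nat.pow_le_pow_right two_pos (hw n))
  have hpair : ∀ a b, a < 2 ^ ((κ + 1) * n.size) → b < 2 ^ ((κ + 1) * n.size) →
      ({(a, b)} : Msg) ∈ Allowed κ w q n := by
    intro a b ha hb
    refine Or.inl ⟨by simp, fun p hp => ?_⟩
    rw [mem_singleton.1 hp]
    exact ⟨ha, hb⟩
  have hlegal : ∀ ω : V → Fin (coins n) → Bool, Legal N.graph (Allowed κ w q n)
      (coverSteps k m r (q n) (tokenBound r n))
      fun v => startState (N.ident v) (lab n (N.ident v) (ω v)) := by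
    intro ω
    refine legal_coverSteps N.connected N.ident_injective _ _ _ _ _ _ ?_ ?_ ?_ ?_
    · exact Or.inl ⟨by simp, by simp⟩
    · exact fun u v => hpair _ _ (hid' u) (hid' v)
    · exact fun v => hpair _ _ (hid' v) (hlab' v _)
    · refine fun x hx h => Or.inr ⟨hx, fun p hp => ?_⟩
      obtain ⟨u, v, rfl⟩ := h p hp
      exact ⟨hlab n _ _ (hid u), hlab n _ _ (hid v)⟩
  have hspec := fun ω => toAlgorithm_spec (coins := coins)
    (start := fun n i x => startState i (lab n i x))
    (steps := fun n => coverSteps k m r (q n) (tokenBound r n))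
    (out := fun n => output r (tokenBound r n)) (B := 2 * κ + 4) N ω hdec hlen (hlegal ω)
  refine ⟨fun ω => ⟨(hspec ω).1, fun R hR => (hspec ω).2.1 R ?_⟩, ?_⟩
  · rw [length_coverSteps]
    push_cast at hR ⊢
    exact hR
  obtain ⟨W, hW, hout⟩ := output_coverSteps N.connected N.ident_injective hk hr (hq n)
    (show tokenBound r n = min (2 * r ^ 2) (Fintype.card V ^ 2) from rfl)
  refine ⟨W, hW, fun ω hω α hα => ?_⟩
  have hans := (hspec ω).2.2
  rcases hout _ hω with ⟨h1, h2⟩ | ⟨C, hC, hcard, h1⟩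
  · constructor
    · rintro ⟨S, hS, hSk⟩
      have h3 := h2 S.toFinite.toFinset (by simpa using hS)
      rw [Set.ncard_eq_toFinset_card S] at hSk
      omega
    · exact fun _ => Or.inl fun v => by
        have h3 := hans v
        simp only [← hn, h1] at h3
        exact h3
  · have hfind : (coverAlgorithm k m r coins lab q enc dec).FindsCover N ω (α * k) := by
      refine ⟨C, hC, ?_, fun v hv => ?_, fun v hv => ?_⟩
      · rw [Set.ncard_coe_finset]
        refine le_trans ?_ hα
        exact_mod_cast hcard
      · have h3 := hans v
        simp only [← hn, h1, if_pos (mem_coe.1 hv)] at h3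
        exact h3
      · have h3 := hans v
        simp only [← hn, h1, if_neg (fun h => hv (mem_coe.2 h))] at h3
        exact h3
    exact ⟨fun _ => hfind, fun _ => Or.inr hfind⟩

end

/-! ### Random labels -/

/-- Overwriting the value at `u` of a colliding `ω` by an arbitrary element loses nothing, since the
old value can be read off at `v`. -/
lemma ncard_eq_mul_card_le {V β : Type*} [Finite V] [Finite β] {u v : V} (huv : u ≠ v) :
    {ω : V → β | ω u = ω v}.ncard * Nat.card β ≤ Nat.card (V → β) := by
  rw [← Nat.card_coe_set_eq, ← Nat.card_prod]
  refine Nat.card_le_card_of_injective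
    (fun p : {ω : V → β | ω u = ω v} × β => Function.update p.1.1 u p.2) ?_
  rintro ⟨⟨ω, hω⟩, b⟩ ⟨⟨ω', hω'⟩, b'⟩ h
  simp only [Set.mem_ofPred_eq] at hω hω'
  simp only at h
  have hb : b = b' := by simpa using congrFun h u
  have hne : ∀ x, x ≠ u → ω x = ω' x := fun x hx => by simpa [hx] using congrFun h x
  have : ω = ω' := by
    funext x
    by_cases hx : x = u
    · rw [hx, hω, hω', hne v huv.symm]
    · exact hne x hx
  subst this hb
  rfl

/-- The union bound for a collision in the set `W`. -/
lemma ncard_not_injOn_mul_card_le {V β : Type*} [Finite V] [Finite β] (W : Finset V) :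
    {ω : V → β | ¬ Set.InjOn ω W}.ncard * Nat.card β ≤ W.card ^ 2 * Nat.card (V → β) := by
  have hsub : {ω : V → β | ¬ Set.InjOn ω W} ⊆
      ⋃ p ∈ W.offDiag, {ω : V → β | ω p.1 = ω p.2} := by
    intro ω hω
    simp only [Set.mem_ofPred_eq, Set.InjOn] at hω
    push Not at hω
    obtain ⟨u, hu, v, hv, h, hne⟩ := hω
    simp only [Set.mem_iUnion]
    exact ⟨(u, v), mem_offDiag.2 ⟨hu, hv, hne⟩, h⟩
  have h1 := (Set.ncard_le_ncard hsub (Set.toFinite _)).trans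
    (Finset.set_ncard_biUnion_le W.offDiag fun p => {ω : V → β | ω p.1 = ω p.2})
  calc _ ≤ (∑ p ∈ W.offDiag, {ω : V → β | ω p.1 = ω p.2}.ncard) * Nat.card β :=
        Nat.mul_le_mul_right _ h1
    _ = ∑ p ∈ W.offDiag, {ω : V → β | ω p.1 = ω p.2}.ncard * Nat.card β := sum_mul _ _ _
    _ ≤ ∑ p ∈ W.offDiag, Nat.card (V → β) :=
        sum_le_sum fun p hp => ncard_eq_mul_card_le (mem_offDiag.1 hp).2.2
    _ = W.offDiag.card * Nat.card (V → β) := by rw [sum_const, smul_eq_mul]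
    _ ≤ W.card ^ 2 * Nat.card (V → β) := by
        refine Nat.mul_le_mul_right _ ?_
        rw [offDiag_card, sq]
        omega

/-- The number of bits of the random labels. -/
def labelBits (c r : ℕ) : ℕ := (36 * r ^ (c + 4)).size

lemma one_le_labelBits {c r : ℕ} (hr : 1 ≤ r) : 1 ≤ labelBits c r :=
  one_le_size (Nat.succ_le_of_lt (by positivity))

lemma lt_two_pow_labelBits (c r : ℕ) : 36 * r ^ (c + 4) < 2 ^ labelBits c r := Nat.lt_size_self _

lemma labelBits_le_log {c r : ℕ} {x : ℝ} (hr : 1 ≤ r) (hx : 2 < x) (hrx : (r : ℝ) ≤ 2 * x) :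
    (labelBits c r : ℝ) ≤ (30 + 4 * c) * Real.log x := by
  obtain ⟨l, hl⟩ : ∃ l, labelBits c r = l + 1 :=
    ⟨_, (Nat.sub_add_cancel (one_le_labelBits hr)).symm⟩
  have h1 : 2 ^ l ≤ 36 * r ^ (c + 4) := Nat.lt_size.1 (by
    rw [← labelBits, hl]
    exact Nat.lt_succ_self l)
  have h1' : (2 : ℝ) ^ l ≤ 2 ^ 6 * r ^ (c + 4) := by
    have : (2 : ℝ) ^ l ≤ 36 * r ^ (c + 4) := by exact_mod_cast h1
    have h : (0 : ℝ) ≤ (r : ℝ) ^ (c + 4) := by positivity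
    linarith
  have hr0 : (0 : ℝ) < r := by exact_mod_cast hr
  have h2 := Real.log_le_log (by positivity) h1'
  rw [Real.log_pow, Real.log_mul (by positivity) (by positivity), Real.log_pow, Real.log_pow] at h2
  push_cast at h2
  have h3 : Real.log r ≤ Real.log 2 + Real.log x := by
    rw [← Real.log_mul (by norm_num) (by positivity)]
    exact Real.log_le_log hr0 hrx
  have h4 : Real.log 2 ≤ Real.log x := Real.log_le_log (by norm_num) hx.le
  have h5 : (1 : ℝ) / 2 ≤ Real.log 2 := by have := Real.log_two_gt_d9; linarith
  have h6 : ((c : ℝ) + 4) * Real.log r ≤ (c + 4) * (2 * Real.log x) :=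
    mul_le_mul_of_nonneg_left (by linarith) (by positivity)
  have h7 : (l : ℝ) * (1 / 2) ≤ l * Real.log 2 := mul_le_mul_of_nonneg_left h5 (by positivity)
  rw [hl]
  push_cast
  linarith

/-- The number of tokens that fit into one message. -/
def tokensPerMessage (c r n : ℕ) : ℕ :=
  if labelBits c r ≤ n.size then n.size / labelBits c r else 1

lemma one_le_tokensPerMessage {c r : ℕ} (hr : 1 ≤ r) (n : ℕ) : 1 ≤ tokensPerMessage c r n := by
  unfold tokensPerMessage
  split_ifs with h
  · exact (Nat.one_le_div_iff (one_le_labelBits hr)).2 h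
  · exact le_rfl

/-- Rounding down costs at most a factor of two, because the quotient is at least one. -/
lemma size_le_mul_tokensPerMessage {c r : ℕ} (hr : 1 ≤ r) (n : ℕ) :
    n.size ≤ 2 * labelBits c r * tokensPerMessage c r n := by
  have hl := one_le_labelBits (c := c) hr
  have hq := one_le_tokensPerMessage (c := c) hr n
  unfold tokensPerMessage at hq ⊢
  split_ifs at hq ⊢ with h
  · have := (Nat.lt_mul_div_succ n.size hl).le
    nlinarith
  · omega

/-- The quotient is at most `4 * r ^ 2 * l / log n` with `l` label bits. For `x > 2` both `r = O(x)`
and `l = O(log x)`. For `x ≤ 2` the factor `log x` may vanish, but then `r ≤ 2` and the bound is a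
constant, charged to `k`. -/
lemma tokenBound_div_le {c r n : ℕ} {x : ℝ} (hx : 1 ≤ x) (hr : r = ⌈x⌉₊) (hn : 1 ≤ n) {k : ℕ}
    (hk : 1 ≤ k) :
    ((tokenBound r n / tokensPerMessage c r n : ℕ) : ℝ) ≤
      (1 + 32 * labelBits c 2) * k + 16 * (30 + 4 * c) * (x ^ 2 * Real.log x / Real.log n) := by
  have hk' : (1 : ℝ) ≤ k := by exact_mod_cast hk
  have hr1 : 1 ≤ r := hr ▸ Nat.one_le_ceil_iff.2 (by linarith)
  have hlogx : 0 ≤ Real.log x := Real.log_nonneg hx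
  have hlam : (0 : ℝ) ≤ labelBits c 2 := by positivity
  rcases hn.eq_or_lt with rfl | hn2
  · have h1 : tokenBound r 1 / tokensPerMessage c r 1 ≤ 1 :=
      (Nat.div_le_self _ _).trans (min_le_right _ _)
    have h1' : ((tokenBound r 1 / tokensPerMessage c r 1 : ℕ) : ℝ) ≤ 1 := by exact_mod_cast h1
    simp only [Nat.cast_one, Real.log_one, div_zero, mul_zero, add_zero]
    nlinarith
  have hL : 1 / 2 ≤ Real.log n := by
    have h1 : Real.log 2 ≤ Real.log n := Real.log_le_log (by norm_num) (by exact_mod_cast hn2)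
    have := Real.log_two_gt_d9
    linarith
  have hL0 : 0 < Real.log n := by linarith
  have hLb : Real.log n ≤ n.size := by
    have h1 : (n : ℝ) ≤ 2 ^ n.size := by exact_mod_cast (Nat.lt_size_self n).le
    have h2 := Real.log_le_log (by exact_mod_cast hn) h1
    rw [Real.log_pow] at h2
    have h3 := Real.log_two_lt_d9
    have h4 : (0 : ℝ) ≤ n.size := by positivity
    nlinarith
  set l : ℝ := (labelBits c r : ℝ) with hl
  set q : ℝ := (tokensPerMessage c r n : ℝ) with hq
  have hq1 : 1 ≤ q := Nat.one_le_cast.2 (one_le_tokensPerMessage hr1 n)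
  have hl1 : 1 ≤ l := Nat.one_le_cast.2 (one_le_labelBits hr1)
  have hLq : Real.log n ≤ 2 * l * q :=
    hLb.trans (by
      rw [hl, hq]
      exact_mod_cast size_le_mul_tokensPerMessage (c := c) hr1 n)
  have hT : (tokenBound r n : ℝ) ≤ 2 * r ^ 2 := by exact_mod_cast min_le_left _ _
  have hmain : ((tokenBound r n / tokensPerMessage c r n : ℕ) : ℝ) ≤
      4 * r ^ 2 * l / Real.log n := by
    refine Nat.cast_div_le.trans ?_
    rw [div_le_div_iff₀ (by linarith) hL0]
    calc (tokenBound r n : ℝ) * Real.log n ≤ (2 * r ^ 2) * (2 * l * q) :=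
          mul_le_mul hT hLq hL0.le (by positivity)
      _ = 4 * r ^ 2 * l * q := by ring
  refine hmain.trans ?_
  have hfrac : 0 ≤ x ^ 2 * Real.log x / Real.log n := by positivity
  rcases le_or_gt x 2 with hx2 | hx2
  · have hr2 : r ≤ 2 := hr ▸ Nat.ceil_le.2 (by exact_mod_cast hx2)
    have hl2 : l ≤ labelBits c 2 := by
      rw [hl]
      exact_mod_cast Nat.size_le_size (Nat.mul_le_mul_left _ (Nat.pow_le_pow_left hr2 _))
    have hr2' : (r : ℝ) ^ 2 ≤ 4 := by
      have : r ^ 2 ≤ 2 ^ 2 := Nat.pow_le_pow_left hr2 2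
      exact_mod_cast this
    have h1 : 4 * (r : ℝ) ^ 2 * l / Real.log n ≤ 32 * labelBits c 2 := by
      rw [div_le_iff₀ hL0]
      have h2 : (r : ℝ) ^ 2 * l ≤ 4 * labelBits c 2 :=
        mul_le_mul hr2' hl2 (by linarith) (by norm_num)
      nlinarith
    have h3 : 0 ≤ 16 * (30 + 4 * (c : ℝ)) * (x ^ 2 * Real.log x / Real.log n) := by positivity
    nlinarith
  · have hrx : (r : ℝ) ≤ 2 * x := by
      have := Nat.ceil_lt_add_one (by linarith : (0 : ℝ) ≤ x)
      rw [← hr] at this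
      linarith
    have hl2 : l ≤ (30 + 4 * c) * Real.log x := labelBits_le_log hr1 hx2 hrx
    have hr2 : (r : ℝ) ^ 2 ≤ 4 * x ^ 2 := by
      have : (0 : ℝ) ≤ r := by positivity
      nlinarith
    have h1 : 4 * (r : ℝ) ^ 2 * l / Real.log n ≤
        16 * (30 + 4 * c) * (x ^ 2 * Real.log x / Real.log n) := by
      rw [← mul_div_assoc, div_le_div_iff_of_pos_right hL0]
      have h2 : (r : ℝ) ^ 2 * l ≤ 4 * x ^ 2 * ((30 + 4 * c) * Real.log x) :=
        mul_le_mul hr2 hl2 (by linarith) (by positivity)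
      linarith
    have h3 : 0 ≤ (1 + 32 * (labelBits c 2 : ℝ)) * k := by positivity
    linarith

/-- A numbering of the strings of `l` bits. -/
def bitsEquiv (l : ℕ) : (Fin l → Bool) ≃ Fin (2 ^ l) :=
  Fintype.equivFinOfCardEq (by simp)

/-- The random label of a vertex; if the identifier is shorter, it is used instead. -/
def randomLabel (l n i : ℕ) (x : Fin l → Bool) : ℕ :=
  if l ≤ n.size then (bitsEquiv l x : ℕ) else i

end

end Congest

/-! ### Choice of parameters and the error probability. -/

theorem mainTheorem7 :
    (∀ κ : ℕ, ∃ (B : ℕ) (C : ℝ), ∀ (k : ℕ) (ε : ℝ), 1 ≤ k → ε ∈ Set.Icc (1 / (k : ℝ)) 1 →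
      ∃ A : Congest.Algorithm, A.IsDeterministic ∧
        ∀ (V : Type*) [Fintype V] (N : Congest.Network V), N.ShortIdents κ →
          ∀ ω : A.Coins V,
            A.RespectsBandwidth N ω B ∧
            A.HaltsWithin N ω (C * (k + (k * ε) ^ 2)) ∧
            A.Approximates N ω (2 - ε) k) ∧
    (∀ κ c : ℕ, ∃ (B : ℕ) (C : ℝ), ∀ (k : ℕ) (ε δ : ℝ), 1 ≤ k → ε ∈ Set.Icc (1 / (k : ℝ)) 1 →
      ((k * ε) ^ c)⁻¹ ≤ δ →
      ∃ A : Congest.Algorithm,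
        ∀ (V : Type*) [Fintype V] (N : Congest.Network V), N.ShortIdents κ →
          (∀ ω : A.Coins V,
            A.RespectsBandwidth N ω B ∧
            A.HaltsWithin N ω
              (C * (k + (k * ε) ^ 2 * Real.log (k * ε) / Real.log (Fintype.card V)))) ∧
          A.errorProbability N (2 - ε) k ≤ δ) := by
  have params : ∀ (k : ℕ) (ε : ℝ), 1 ≤ k → ε ∈ Set.Icc (1 / (k : ℝ)) 1 →
      1 ≤ (k : ℝ) * ε ∧ ⌈(k : ℝ) * ε⌉₊ ≤ k := by
    intro k ε hk hε
    have hk0 : (0 : ℝ) < k := by exact_mod_cast hk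
    have h1 := (div_le_iff₀' hk0).1 hε.1
    refine ⟨h1, Nat.ceil_le.2 ?_⟩
    nlinarith [hε.2]
  have size : ∀ (k : ℕ) (ε : ℝ), ⌈(k : ℝ) * ε⌉₊ ≤ k →
      2 * ((k - ⌈(k : ℝ) * ε⌉₊ : ℕ) : ℝ) + (⌈(k : ℝ) * ε⌉₊ : ℝ) ≤ (2 - ε) * k := by
    intro k ε h
    have := Nat.le_ceil ((k : ℝ) * ε)
    rw [Nat.cast_sub h]
    linarith
  constructor
  · intro κ
    obtain ⟨enc, dec, hcode⟩ := Congest.exists_codes κ (fun n => κ * n.size) (fun _ => 1) (by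
      intro n hn
      have := Congest.one_le_size hn
      nlinarith)
    -- The program takes `12k + 9 + T` rounds with `T ≤ 2 * r ^ 2 ≤ 8 * (kε) ^ 2`, and `12k + 9 ≤
    -- 21k`.
    refine ⟨2 * κ + 4, 21, fun k ε hk hε => ?_⟩
    obtain ⟨hx, hrk⟩ := params k ε hk hε
    set r := ⌈(k : ℝ) * ε⌉₊ with hr
    have hr1 : 1 ≤ r := Nat.one_le_ceil_iff.2 (by linarith)
    refine ⟨Congest.coverAlgorithm k (k - r) r (fun _ => 0) (fun _ i _ => i) (fun _ => 1) enc dec,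
      fun n => rfl, fun V _ N hN ω => ?_⟩
    obtain ⟨h1, W, -, h2⟩ := Congest.coverAlgorithm_spec (lab := fun _ i _ => i) N
      (by omega : k ≤ (k - r) + r) hr1
      (fun _ => le_rfl) (fun n i x hi => hi)
      (fun n => Nat.mul_le_mul_right _ (Nat.le_succ κ)) hcode hN
    refine ⟨(h1 ω).1, (h1 ω).2 _ ?_, h2 ω (N.ident_injective.injOn) _ (size k ε hrk)⟩
    have hT : ((Congest.tokenBound r (Fintype.card V) / 1 : ℕ) : ℝ) ≤ 2 * r ^ 2 := by
      rw [Nat.div_one]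
      exact_mod_cast min_le_left _ _
    have hr2 : (r : ℝ) ≤ 2 * (k * ε) := by
      have := Nat.ceil_lt_add_one (by linarith : (0 : ℝ) ≤ k * ε)
      rw [← hr] at this
      linarith
    have hk' : (1 : ℝ) ≤ k := by exact_mod_cast hk
    have hr0 : (0 : ℝ) ≤ r := by positivity
    nlinarith
  · intro κ c
    refine ⟨2 * κ + 4, 22 + 32 * Congest.labelBits c 2 + 16 * (30 + 4 * c),
      fun k ε δ hk hε hδ => ?_⟩
    obtain ⟨hx, hrk⟩ := params k ε hk hε
    set r := ⌈(k : ℝ) * ε⌉₊ with hr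
    have hr1 : 1 ≤ r := Nat.one_le_ceil_iff.2 (by linarith)
    set l := Congest.labelBits c r with hl
    have hl1 : 1 ≤ l := Congest.one_le_labelBits hr1
    set w : ℕ → ℕ := fun n => if l ≤ n.size then l else κ * n.size with hw
    obtain ⟨enc, dec, hcode⟩ := Congest.exists_codes κ w (Congest.tokensPerMessage c r) (by
      intro n hn
      have hs := Congest.one_le_size hn
      simp only [hw, Congest.tokensPerMessage, ← hl]
      split_ifs
      · have h1 := Nat.mul_div_le n.size l
        have h2 := Nat.le_mul_of_pos_left (n.size / l) hl1
        nlinarith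
      · nlinarith)
    refine ⟨Congest.coverAlgorithm k (k - r) r (fun _ => l) (Congest.randomLabel l)
      (Congest.tokensPerMessage c r) enc dec, fun V _ N hN => ?_⟩
    obtain ⟨h1, W, hW, h2⟩ := Congest.coverAlgorithm_spec (w := w) (coins := fun _ => l)
      (lab := Congest.randomLabel l) N
      (by omega : k ≤ (k - r) + r) hr1 (Congest.one_le_tokensPerMessage hr1)
      (by
        intro n i x hi
        simp only [hw, Congest.randomLabel]
        split_ifs
        · exact Fin.is_lt _
        · exact hi)
      (by
        intro n
        simp only [hw]
        split_ifs
        · nlinarith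
        · nlinarith) hcode hN
    have := N.connected.nonempty
    have hn1 : 1 ≤ Fintype.card V := Fintype.card_pos
    constructor
    · refine fun ω => ⟨(h1 ω).1, (h1 ω).2 _ ?_⟩
      have hk' : (1 : ℝ) ≤ k := by exact_mod_cast hk
      have h3 := Congest.tokenBound_div_le (c := c) hx hr hn1 hk
      have h4 : 0 ≤ ((k : ℝ) * ε) ^ 2 * Real.log (k * ε) / Real.log (Fintype.card V) := by
        have := Real.log_nonneg hx
        have : 0 ≤ Real.log (Fintype.card V) := Real.log_nonneg (by exact_mod_cast hn1)
        positivity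
      have h5 : (0 : ℝ) ≤ Congest.labelBits c 2 := by positivity
      have h6 : (0 : ℝ) ≤ c := by positivity
      nlinarith [mul_nonneg h5 h4, mul_nonneg h6 (by linarith : (0 : ℝ) ≤ k)]
    · have hδ0 : 0 ≤ δ := le_trans (by positivity) hδ
      -- If the random labels are too long, the algorithm uses identifiers, which are distinct
      -- everywhere, and the error probability is zero.
      by_cases hls : l ≤ (Fintype.card V).size
      · have hsub : {ω : V → Fin l → Bool | ¬ (Congest.coverAlgorithm k (k - r) r (fun _ => l)
            (Congest.randomLabel l) (Congest.tokensPerMessage c r) enc dec).Approximates N ω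
              (2 - ε) k} ⊆ {ω : V → Fin l → Bool | ¬ Set.InjOn ω W} := by
          intro ω hω hinj
          refine hω (h2 ω ?_ _ (size k ε hrk))
          intro u hu v hv huv
          simp only [Congest.randomLabel, if_pos hls] at huv
          exact hinj hu hv ((Congest.bitsEquiv l).injective (Fin.ext huv))
        have h3 := Set.ncard_le_ncard hsub (Set.toFinite _)
        have h4 := Congest.ncard_not_injOn_mul_card_le (β := Fin l → Bool) W
        have hβ : Nat.card (Fin l → Bool) = 2 ^ l := by simp
        rw [hβ] at h4
        have hpos : (0 : ℝ) < Nat.card (V → Fin l → Bool) := by exact_mod_cast Nat.card_pos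
        have hWr : W.card ^ 2 ≤ 36 * r ^ 4 := by
          have hT : Congest.tokenBound r (Fintype.card V) ≤ 2 * r ^ 2 := min_le_left _ _
          have hr2 : 1 ≤ r ^ 2 := Nat.one_le_pow _ _ hr1
          have h6 : W.card ≤ 6 * r ^ 2 := by omega
          calc W.card ^ 2 ≤ (6 * r ^ 2) ^ 2 := Nat.pow_le_pow_left h6 2
            _ = 36 * r ^ 4 := by ring
        have h5 := (Congest.lt_two_pow_labelBits c r).le
        rw [← hl] at h5
        refine le_trans ?_ hδ
        change (Set.ncard _ : ℝ) / (Nat.card (V → Fin l → Bool) : ℝ) ≤ _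
        rw [div_le_iff₀ hpos]
        set a := Set.ncard {ω : V → Fin l → Bool | ¬ (Congest.coverAlgorithm k (k - r) r
          (fun _ => l) (Congest.randomLabel l) (Congest.tokensPerMessage c r) enc
            dec).Approximates N ω (2 - ε) k} with ha
        set t := Nat.card (V → Fin l → Bool) with ht
        -- From `W.card ≤ 6 * r ^ 2` there are at most `36 * r ^ 4` pairs, each colliding with
        -- probability `2 ^ (-l)`. The choice `2 ^ l > 36 * r ^ (c + 4)` in `labelBits` leaves
        -- exactly `r ^ (-c)`.
        have h6 : a * (36 * r ^ (c + 4)) ≤ 36 * r ^ 4 * t :=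
          calc a * (36 * r ^ (c + 4)) ≤ _ * 2 ^ l := Nat.mul_le_mul h3 h5
            _ ≤ W.card ^ 2 * t := h4
            _ ≤ 36 * r ^ 4 * t := Nat.mul_le_mul_right _ hWr
        have h7 : a * r ^ c ≤ t := by
          have h8 : 0 < 36 * r ^ 4 := by positivity
          refine Nat.le_of_mul_le_mul_left ?_ h8
          calc 36 * r ^ 4 * (a * r ^ c) = a * (36 * r ^ (c + 4)) := by ring
            _ ≤ _ := h6
        have h8 : (a : ℝ) * r ^ c ≤ t := by exact_mod_cast h7
        have h9 : ((k : ℝ) * ε) ^ c ≤ (r : ℝ) ^ c :=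
          pow_le_pow_left₀ (by linarith) (Nat.le_ceil _) c
        rw [inv_mul_eq_div, le_div_iff₀ (by positivity)]
        exact (mul_le_mul_of_nonneg_left h9 (by positivity)).trans h8
      · refine le_trans (le_of_eq ?_) hδ0
        have hempty : {ω : V → Fin l → Bool | ¬ (Congest.coverAlgorithm k (k - r) r (fun _ => l)
            (Congest.randomLabel l) (Congest.tokensPerMessage c r) enc dec).Approximates N ω
              (2 - ε) k} = ∅ := by
          refine Set.eq_empty_of_forall_notMem fun ω hω => hω (h2 ω ?_ _ (size k ε hrk))
          simp only [Congest.randomLabel, if_neg hls]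
          exact N.ident_injective.injOn
        change (Set.ncard _ : ℝ) / _ = 0
        rw [div_eq_zero_iff]
        left
        rw [Nat.cast_eq_zero]
        exact (congrArg Set.ncard hempty).trans (Set.ncard_empty _)
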